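/- Let $H$ be a complex Hilbert space. A \emph{spectral operator} is a bounded operator $Z$ on $H$ together with a spectral measure $E_Z$ on the Borel sets of $\mathbb{C}$ (a strongly countably additive, multiplicative family of bounded, not necessarily orthogonal, projections with $E_Z(\mathbb{C})=I$) that commutes with $Z$ and satisfies $E_Z(\sigma(Z))=I$, such that in $$Z=\int_{\sigma(Z)}\lambda\,dE_Z(\lambda)+\int_{\sigma(Z)}(Z-\lambda I)\,dE_Z(\lambda)$$ the second summand is quasi-nilpotent (for instance nilpotent). All operator integrals are limits in operator norm of Riemann--Stieltjes sums over finite tagged Borel partitions as the mesh tends to $0$. The order $m_\lambda\in\mathbb{N}\cup\{\infty\}$ of $(Z-\lambda I)\,dE_Z(\lambda)$ at $\lambda$ is the least $m$ such that $\int_{\sigma(Z)\cap V}(Z-z I)^m\,dE_Z(z)=0$ for some open neighbourhood $V$ of $\lambda$. For functions $\beta$ of two or three complex variables, analytic near the product of the spectra, the generalized double and triple operator integrals are $$T_\beta^{X_1,X_2}(Y)=\sum_{q_1,q_2\ge 0}\ \iint_{q_j<m_{\lambda_j}}\frac{\beta^{(q_1,q_2)}(\lambda_1,\lambda_2)}{q_1!\,q_2!}\,(X_1-\lambda_1I)^{q_1}dE_{X_1}(\lambda_1)\,Y\,(X_2-\lambda_2I)^{q_2}dE_{X_2}(\lambda_2),$$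 $$T_\beta^{X_1,X_2,X_3}(Y_1,Y_2)=\sum_{q_1,q_2,q_3\ge 0}\ \iiint_{q_j<m_{\lambda_j}}\frac{\beta^{(q_1,q_2,q_3)}(\lambda_1,\lambda_2,\lambda_3)}{q_1!\,q_2!\,q_3!}\,(X_1-\lambda_1I)^{q_1}dE_{X_1}(\lambda_1)\,Y_1\,(X_2-\lambda_2I)^{q_2}dE_{X_2}(\lambda_2)\,Y_2\,(X_3-\lambda_3I)^{q_3}dE_{X_3}(\lambda_3),$$ where $\lambda_j$ ranges over $\sigma(X_j)$, the superscripts of $\beta$ denote orders of partial derivatives, and the series are unconditionally convergent sums in operator norm. For $f$ analytic on $\{|z|<R\}$ let $f^{[1]}(x_0,x_1)=\frac{f(x_0)-f(x_1)}{x_0-x_1}$ and $f^{[2]}(x_0,x_1,x_2)=\frac{f^{[1]}(x_0,x_1)-f^{[1]}(x_0,x_2)}{x_1-x_2}$ be its first and second divided differences (with the corresponding derivatives at coinciding arguments). \textbf{Lemma.} Let $A,B,X$ be spectral operators on $H$ with spectra contained in $\{|z|<R\}$, let $f$ be analytic on $\{|z|<R\}$, and let $Y$ be a bounded operator on $H$.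 Then $T_{f^{[1]}}^{A,X}(Y)$, $T_{f^{[1]}}^{B,X}(Y)$ and $T_{f^{[2]}}^{A,B,X}(A-B,Y)$ exist, are uniquely determined, and satisfy $$T_{f^{[1]}}^{A,X}(Y)-T_{f^{[1]}}^{B,X}(Y)=T_{f^{[2]}}^{A,B,X}(A-B,Y).$$ -/

import Mathlib

open scoped ENNReal

/-- A tagged finite Borel partition of a region `R ⊆ ℂ`: finitely many pairwise disjoint Borel cells
with union `R`, and a point chosen in every cell. -/
structure TaggedPartition (R : Set ℂ) where
  /-- number of cells -/
  n : ℕ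
  /-- the cells -/
  cell : Fin n → Set ℂ
  /-- the chosen points -/
  tag : Fin n → ℂ
  measurableSet_cell : ∀ i, MeasurableSet (cell i)
  pairwise_disjoint : Pairwise fun i j => Disjoint (cell i) (cell j)
  iUnion_cell : (⋃ i, cell i) = R
  tag_mem : ∀ i, tag i ∈ cell i

/-- Every cell of the partition has diameter at most `δ`. -/
def TaggedPartition.MeshLE {R : Set ℂ} (P : TaggedPartition R) (δ : ℝ) : Prop :=
  ∀ i, ∀ x ∈ P.cell i, ∀ y ∈ P.cell i, dist x y ≤ δ

/-- A spectral measure on the Borel sets of `ℂ`: a strongly countably additive, multiplicative family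
of bounded (not necessarily orthogonal) projections with total mass the identity.
Values at sets that are not Borel play no role. -/
structure SpectralMeasure (H : Type*) [NormedAddCommGroup H] [InnerProductSpace ℂ H] where
  /-- the projection `E(s)` -/
  proj : Set ℂ → H →L[ℂ] H
  proj_univ : proj Set.univ = 1
  proj_inter : ∀ s t, MeasurableSet s → MeasurableSet t → proj (s ∩ t) = proj s * proj t
  hasSum_proj : ∀ s : ℕ → Set ℂ, (∀ k, MeasurableSet (s k)) →
    (Pairwise fun i j => Disjoint (s i) (s j)) →
    ∀ v, HasSum (fun k => proj (s k) v) (proj (⋃ k, s k) v)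

section

variable {H : Type*} [NormedAddCommGroup H] [InnerProductSpace ℂ H]

/-- `∫_{λ ∈ R} F(λ) dE(λ) = T` for an operator-valued `F`: the Riemann–Stieltjes sums
`∑ᵢ F(λᵢ) E(Δᵢ)` over tagged partitions of `R` tend to `T` in operator norm as the mesh tends to `0`. -/
def HasSpectralIntegral (E : SpectralMeasure H) (R : Set ℂ) (F : ℂ → H →L[ℂ] H)
    (T : H →L[ℂ] H) : Prop :=
  ∀ ε : ℝ, 0 < ε → ∃ δ : ℝ, 0 < δ ∧ ∀ P : TaggedPartition R, P.MeshLE δ →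
    ‖(∑ i, F (P.tag i) * E.proj (P.cell i)) - T‖ ≤ ε

end

/-- A bounded operator `X` with a spectral decomposition
`X = ∫ λ dE(λ) + ∫ (X - λ) dE(λ)` over its spectrum: `E` commutes with `X`, is concentrated on `σ(X)`,
and the second summand is quasi-nilpotent (in particular it may be nilpotent, or zero).
These are the bounded spectral operators in the sense of Dunford, with their resolution of identity. -/
structure SpectralOperator (H : Type*) [NormedAddCommGroup H] [InnerProductSpace ℂ H] where
  /-- the operator `X` -/
  op : H →L[ℂ] H
  /-- its spectral measure `E_X` -/
  E : SpectralMeasure H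
  commute_proj : ∀ s, MeasurableSet s → Commute op (E.proj s)
  proj_spectrum : E.proj (spectrum ℂ op) = 1
  quasinilpotent : ∃ N : H →L[ℂ] H,
    HasSpectralIntegral E (spectrum ℂ op) (fun z => op - z • (1 : H →L[ℂ] H)) N ∧
      spectralRadius ℂ N = 0

section

variable {H : Type*} [NormedAddCommGroup H] [InnerProductSpace ℂ H]

/-- The order `m_λ` of the nilpotent `(X - λ) dE(λ)` at the point `λ`: the least `m` such that
`∫ (X - z)^m dE(z) = 0` over the part of the spectrum in some neighbourhood of `λ`
(and `⊤` if there is none). For an isolated point `λ` of the spectrum this is the order of the nilpotent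
operator `(X - λ) E({λ})`. -/
noncomputable def SpectralOperator.order (X : SpectralOperator H) (lam : ℂ) : ℕ∞ :=
  sInf {m : ℕ∞ | ∃ k : ℕ, m = k ∧ ∃ V : Set ℂ, IsOpen V ∧ lam ∈ V ∧
    HasSpectralIntegral X.E (spectrum ℂ X.op ∩ V)
      (fun z => (X.op - z • (1 : H →L[ℂ] H)) ^ k) 0}

/-- The points `λ` of the spectrum of `X` at which the `q`-th term of `∑_{q < m_λ}` is present. -/
def SpectralOperator.region (X : SpectralOperator H) (q : ℕ) : Set ℂ :=
  {z | z ∈ spectrum ℂ X.op ∧ (q : ℕ∞) < X.order z}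

/-- The Riemann–Stieltjes increment `(X - λᵢ)^q E(Δᵢ)` standing for `(X - λ)^q dE(λ)`. -/
noncomputable def SpectralOperator.incr (X : SpectralOperator H) (q : ℕ) {R : Set ℂ}
    (P : TaggedPartition R) (i : Fin P.n) : H →L[ℂ] H :=
  (X.op - P.tag i • (1 : H →L[ℂ] H)) ^ q * X.E.proj (P.cell i)

/-- `∬ g(λ₁,λ₂) (X₁-λ₁)^{q₁} dE₁(λ₁) Y (X₂-λ₂)^{q₂} dE₂(λ₂) = T`, the integral being over those points
of the spectra with `q₁ < m_{λ₁}`, `q₂ < m_{λ₂}`, as the operator-norm limit of Riemann–Stieltjes sums. -/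
def HasDoubleIntegral (g : ℂ → ℂ → ℂ) (q₁ q₂ : ℕ) (X₁ X₂ : SpectralOperator H)
    (Y T : H →L[ℂ] H) : Prop :=
  ∀ ε : ℝ, 0 < ε → ∃ δ : ℝ, 0 < δ ∧
    ∀ (P₁ : TaggedPartition (X₁.region q₁)) (P₂ : TaggedPartition (X₂.region q₂)),
      P₁.MeshLE δ → P₂.MeshLE δ →
      ‖(∑ i, ∑ j, g (P₁.tag i) (P₂.tag j) • (X₁.incr q₁ P₁ i * Y * X₂.incr q₂ P₂ j)) - T‖ ≤ ε

/-- The triple integral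
`∭ g(λ₁,λ₂,λ₃) (X₁-λ₁)^{q₁} dE₁(λ₁) Y₁ (X₂-λ₂)^{q₂} dE₂(λ₂) Y₂ (X₃-λ₃)^{q₃} dE₃(λ₃) = T`. -/
def HasTripleIntegral (g : ℂ → ℂ → ℂ → ℂ) (q₁ q₂ q₃ : ℕ) (X₁ X₂ X₃ : SpectralOperator H)
    (Y₁ Y₂ T : H →L[ℂ] H) : Prop :=
  ∀ ε : ℝ, 0 < ε → ∃ δ : ℝ, 0 < δ ∧
    ∀ (P₁ : TaggedPartition (X₁.region q₁)) (P₂ : TaggedPartition (X₂.region q₂))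
      (P₃ : TaggedPartition (X₃.region q₃)),
      P₁.MeshLE δ → P₂.MeshLE δ → P₃.MeshLE δ →
      ‖(∑ i, ∑ j, ∑ k, g (P₁.tag i) (P₂.tag j) (P₃.tag k) •
        (X₁.incr q₁ P₁ i * Y₁ * X₂.incr q₂ P₂ j * Y₂ * X₃.incr q₃ P₃ k)) - T‖ ≤ ε

/-- `β^{(q₁,q₂)} / (q₁! q₂!)`. -/
noncomputable def taylorCoeff₂ (β : ℂ → ℂ → ℂ) (q₁ q₂ : ℕ) (x y : ℂ) : ℂ :=
  iteratedDeriv q₁ (fun x' => iteratedDeriv q₂ (fun y' => β x' y') y) x /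
    ((q₁.factorial : ℂ) * (q₂.factorial : ℂ))

/-- `β^{(q₁,q₂,q₃)} / (q₁! q₂! q₃!)`. -/
noncomputable def taylorCoeff₃ (β : ℂ → ℂ → ℂ → ℂ) (q₁ q₂ q₃ : ℕ) (x y z : ℂ) : ℂ :=
  iteratedDeriv q₁
      (fun x' => iteratedDeriv q₂ (fun y' => iteratedDeriv q₃ (fun z' => β x' y' z') z) y) x /
    ((q₁.factorial : ℂ) * (q₂.factorial : ℂ) * (q₃.factorial : ℂ))

/-- `T` is the generalized double operator integral of `β`: the sum of the double integrals of
`β^{(q₁,q₂)}/(q₁! q₂!)` against `(X₁-λ₁)^{q₁} dE₁(λ₁) Y (X₂-λ₂)^{q₂} dE₂(λ₂)` over all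
`0 ≤ q₁ < m_{λ₁}`, `0 ≤ q₂ < m_{λ₂}`. The four groups of terms of the usual display are those with
`q₁`, `q₂` zero or positive. -/
def IsGDOI (β : ℂ → ℂ → ℂ) (X₁ X₂ : SpectralOperator H) (Y T : H →L[ℂ] H) : Prop :=
  ∃ I : ℕ × ℕ → H →L[ℂ] H,
    (∀ q₁ q₂, HasDoubleIntegral (taylorCoeff₂ β q₁ q₂) q₁ q₂ X₁ X₂ Y (I (q₁, q₂))) ∧ HasSum I T

/-- `T` is the generalized triple operator integral of `β`; the eight groups of terms of the usual
display are those with `q₁`, `q₂`, `q₃` zero or positive. -/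
def IsGTOI (β : ℂ → ℂ → ℂ → ℂ) (X₁ X₂ X₃ : SpectralOperator H) (Y₁ Y₂ T : H →L[ℂ] H) : Prop :=
  ∃ I : ℕ × ℕ × ℕ → H →L[ℂ] H,
    (∀ q₁ q₂ q₃, HasTripleIntegral (taylorCoeff₃ β q₁ q₂ q₃) q₁ q₂ q₃ X₁ X₂ X₃ Y₁ Y₂
      (I (q₁, q₂, q₃))) ∧ HasSum I T

open Classical in
/-- The generalized double operator integral `T_β^{X₁,X₂}(Y)` (`0` if it does not exist). -/
noncomputable def gdoi (β : ℂ → ℂ → ℂ) (X₁ X₂ : SpectralOperator H) (Y : H →L[ℂ] H) : H →L[ℂ] H :=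
  if h : ∃ T, IsGDOI β X₁ X₂ Y T then h.choose else 0

open Classical in
/-- The generalized triple operator integral `T_β^{X₁,X₂,X₃}(Y₁,Y₂)` (`0` if it does not exist). -/
noncomputable def gtoi (β : ℂ → ℂ → ℂ → ℂ) (X₁ X₂ X₃ : SpectralOperator H)
    (Y₁ Y₂ : H →L[ℂ] H) : H →L[ℂ] H :=
  if h : ∃ T, IsGTOI β X₁ X₂ X₃ Y₁ Y₂ T then h.choose else 0

end

/-- First divided difference: `f^{[1]}(x₀,x₁) = (f x₁ - f x₀) / (x₁ - x₀)`, and `f'(x₀)` if `x₁ = x₀`. -/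
noncomputable def divDiff₁ (f : ℂ → ℂ) (x₀ x₁ : ℂ) : ℂ :=
  dslope f x₀ x₁

/-- Second divided difference:
`f^{[2]}(x₀,x₁,x₂) = (f^{[1]}(x₀,x₂) - f^{[1]}(x₀,x₁)) / (x₂ - x₁)`, and the derivative of
`f^{[1]}(x₀,·)` at `x₁` if `x₂ = x₁`. -/
noncomputable def divDiff₂ (f : ℂ → ℂ) (x₀ x₁ x₂ : ℂ) : ℂ :=
  dslope (fun t => divDiff₁ f x₀ t) x₁ x₂

/-!
Expand `f(z) = ∑ aₙ zⁿ` on the disc. Then `f^{[1]}(x, y) = ∑ a_{k+l+1} x^k y^l` and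
`f^{[2]}(x, y, z) = ∑ a_{k+l+m+2} x^k y^l z^m`, absolutely convergent on every smaller polydisc
(`SummableBelow.hasSum_dslope`, `SummableBelow.hasSum_divDiff₂`). The operator integrals turn out to be
the same series in the operators: `T_{f^{[1]}}^{A,X}(Y) = ∑ a_{k+l+1} A^k Y X^l`, and
`T_{f^{[2]}}^{A,B,X}(A - B, Y) = ∑ a_{k+l+m+2} A^k (A - B) B^l Y X^m` (`isGDOI_tsum`, `isGTOI_tsum`).
The perturbation formula is then the telescoping identity
`A^{n+1} - B^{n+1} = ∑_{i+j=n} A^i (A - B) B^j`, applied term by term (`tsum_sub_tsum_eq_tsum`).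

For the integrals, let `X = S + N` be the decomposition into commuting scalar and quasi-nilpotent parts,
where `S` is the limit of the step operators `S_P = ∑ λᵢ E(Δᵢ)`. By multiplicativity of `E`,
`∑ λᵢ^k (X - λᵢ)^q E(Δᵢ) = S_P^k (X - S_P)^q E(Ω)` for every partition `P` of `Ω`
(`SpectralOperator.powSum_eq`), so these sums converge to `S^k N^q E(Ω)`. On the region `q < m_λ` the last
factor may be dropped, because `N^q` vanishes near all other points of the spectrum
(`SpectralOperator.sub_pow_mul_proj_region`). Hence the integral of the `q`-th Taylor coefficient of `z^k`
is `(k choose q) S^{k-q} N^q`, and these add up to `X^k` by the binomial theorem.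

Power series may be integrated term by term by dominated convergence. The majorant does not require the
uniform boundedness of `E`: by Gelfand's formula `‖S^k‖` and `‖N^q‖` grow geometrically, with ratios
whose sum can be kept below the radius of the disc, and a bound `‖S^k‖ ≤ C r^k` persists, for all `k` at
once and with a slightly larger `r`, for all operators close to `S`, in particular for `S_P` with `P` fine
(`exists_eventually_norm_pow_le`, `SpectralOperator.nonempty_jetExpansion`).
-/

open Filter Topology

/-! ### Tagged partitions and spectral measures -/

namespace TaggedPartition

variable {R : Set ℂ}

/-- The filter of tagged partitions of `R` whose mesh tends to `0`. -/
def meshFilter (R : Set ℂ) : Filter (TaggedPartition R) :=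
  ⨅ δ ∈ Set.Ioi (0 : ℝ), 𝓟 {P | P.MeshLE δ}

lemma MeshLE.mono {P : TaggedPartition R} {δ δ' : ℝ} (h : P.MeshLE δ) (hδ : δ ≤ δ') :
    P.MeshLE δ' := fun i x hx y hy => (h i x hx y hy).trans hδ

lemma meshFilter_hasBasis (R : Set ℂ) :
    (meshFilter R).HasBasis (fun δ : ℝ => 0 < δ) fun δ => {P | P.MeshLE δ} := by
  refine hasBasis_biInf_principal (s := fun δ : ℝ => {P : TaggedPartition R | P.MeshLE δ})
    (S := Set.Ioi 0) ?_ ⟨1, Set.mem_Ioi.2 one_pos⟩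
  intro a ha b hb
  exact ⟨min a b, lt_min (Set.mem_Ioi.1 ha) (Set.mem_Ioi.1 hb),
    fun P hP => hP.mono (min_le_left _ _), fun P hP => hP.mono (min_le_right _ _)⟩

lemma cell_subset (P : TaggedPartition R) (i : Fin P.n) : P.cell i ⊆ R :=
  (Set.subset_iUnion P.cell i).trans P.iUnion_cell.subset

lemma tag_mem_region (P : TaggedPartition R) (i : Fin P.n) : P.tag i ∈ R :=
  P.cell_subset i (P.tag_mem i)

/-- Discarding the empty members, a finite measurable partition becomes a tagged one, with the tags
prescribed by `t`. -/
lemma exists_of_finite {ι : Type*} [Finite ι] (s : ι → Set ℂ) (hs : ∀ i, MeasurableSet (s i))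
    (hd : Pairwise fun i j => Disjoint (s i) (s j)) (hU : ⋃ i, s i = R)
    (t : ι → ℂ) (ht : ∀ i, (s i).Nonempty → t i ∈ s i) :
    ∃ P : TaggedPartition R, ∃ e : Fin P.n ≃ {i // (s i).Nonempty},
      (∀ i, P.cell i = s (e i)) ∧ ∀ i, P.tag i = t (e i) := by
  obtain ⟨n, ⟨e⟩⟩ := Finite.exists_equiv_fin {i // (s i).Nonempty}
  refine ⟨⟨n, fun i => s (e.symm i), fun i => t (e.symm i), fun i => hs _, ?_, ?_, ?_⟩, e.symm,
    fun i => rfl, fun i => rfl⟩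
  · intro i j hij
    exact hd fun h => hij (e.symm.injective (Subtype.ext h))
  · rw [← hU]
    ext z
    simp only [Set.mem_iUnion]
    constructor
    · rintro ⟨i, hi⟩
      exact ⟨_, hi⟩
    · rintro ⟨i, hi⟩
      exact ⟨e ⟨i, z, hi⟩, by simpa using hi⟩
  · intro i
    exact ht _ (e.symm i).2

lemma exists_meshLE (hR : MeasurableSet R) (hb : Bornology.IsBounded R) {δ : ℝ} (hδ : 0 < δ) :
    ∃ P : TaggedPartition R, P.MeshLE δ := by
  classical
  obtain ⟨t, ht, hRt⟩ := Metric.totallyBounded_iff.1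
    (hb.isCompact_closure.totallyBounded.subset subset_closure) (δ / 2) (half_pos hδ)
  obtain ⟨n, ⟨e⟩⟩ := @Finite.exists_equiv_fin t ht
  let b : Fin n → Set ℂ := fun i => R ∩ Metric.ball (e.symm i).1 (δ / 2)
  have hbm : ∀ i, MeasurableSet (b i) := fun i => hR.inter measurableSet_ball
  have hU : ⋃ i, disjointed b i = R := by
    rw [iUnion_disjointed]
    apply subset_antisymm
    · exact Set.iUnion_subset fun i => Set.inter_subset_left
    · intro z hz
      obtain ⟨y, hy, hzy⟩ := Set.mem_iUnion₂.1 (hRt hz)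
      exact Set.mem_iUnion.2 ⟨e ⟨y, hy⟩, hz, by simpa using hzy⟩
  obtain ⟨P, e', hc, -⟩ := exists_of_finite (disjointed b)
    (fun i => disjointedRec (fun _ _ h => h.diff (hbm _)) (hbm i)) (disjoint_disjointed b) hU
    (fun i => if h : (disjointed b i).Nonempty then h.choose else 0)
    (fun i h => by simpa [h] using h.choose_spec)
  refine ⟨P, fun i x hx y hy => ?_⟩
  rw [hc] at hx hy
  have hx' := (disjointed_subset b _ hx).2
  have hy' := (disjointed_subset b _ hy).2
  have h1 := Metric.mem_ball.1 hx'
  have h2 := Metric.mem_ball.1 hy'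
  have h3 := dist_triangle_right x y (e.symm (e' i).1).1
  linarith

/-- A tagged partition of a subregion can be completed to one of the whole region without
enlarging the mesh beyond a given bound. -/
lemma exists_extension {R₀ : Set ℂ} (hR₀ : MeasurableSet R₀) (hb : Bornology.IsBounded R₀)
    (hR : MeasurableSet R) (hRR : R ⊆ R₀) {δ : ℝ} (hδ : 0 < δ) (P : TaggedPartition R)
    (hP : P.MeshLE δ) :
    ∃ P' : TaggedPartition R₀, P'.MeshLE δ ∧
      ∀ i, ∃ j, P'.cell j = P.cell i ∧ P'.tag j = P.tag i := by
  obtain ⟨Q, hQ⟩ := exists_meshLE (hR₀.diff hR) (hb.subset Set.sdiff_subset) hδ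
  let s : Fin P.n ⊕ Fin Q.n → Set ℂ := Sum.elim P.cell Q.cell
  have hPR : ∀ i, P.cell i ⊆ R := P.cell_subset
  have hQR : ∀ i, Q.cell i ⊆ R₀ \ R := Q.cell_subset
  have hPQ : ∀ i j, Disjoint (P.cell i) (Q.cell j) := fun i j =>
    Set.disjoint_left.2 fun z hz hz' => (hQR j hz').2 (hPR i hz)
  obtain ⟨P', e, hc, ht⟩ := exists_of_finite (R := R₀) s
    (by rintro (i | i); exacts [P.measurableSet_cell i, Q.measurableSet_cell i])
    (by
      rintro (i | i) (j | j) hij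
      · exact P.pairwise_disjoint fun h => hij (congrArg _ h)
      · exact hPQ i j
      · exact (hPQ j i).symm
      · exact Q.pairwise_disjoint fun h => hij (congrArg _ h))
    (by
      rw [Set.iUnion_sum]
      simp only [s, Sum.elim_inl, Sum.elim_inr]
      rw [P.iUnion_cell, Q.iUnion_cell, Set.union_sdiff_cancel hRR])
    (Sum.elim P.tag Q.tag)
    (by rintro (i | i) _; exacts [P.tag_mem i, Q.tag_mem i])
  refine ⟨P', fun j x hx y hy => ?_, fun i => ?_⟩
  · rw [hc] at hx hy
    rcases h : (e j).1 with i | i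
    · rw [h] at hx hy
      exact hP i x hx y hy
    · rw [h] at hx hy
      exact hQ i x hx y hy
  · refine ⟨e.symm ⟨Sum.inl i, ⟨_, P.tag_mem i⟩⟩, ?_, ?_⟩
    · simp [hc, s]
    · simp [ht]

lemma meshFilter_neBot (hR : MeasurableSet R) (hb : Bornology.IsBounded R) :
    (meshFilter R).NeBot :=
  (meshFilter_hasBasis R).neBot_iff.2 fun hδ => exists_meshLE hR hb hδ

end TaggedPartition

namespace SpectralMeasure

variable {H : Type*} [NormedAddCommGroup H] [InnerProductSpace ℂ H] (E : SpectralMeasure H)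

lemma proj_empty : E.proj ∅ = 0 := by
  ext v
  have h := (E.hasSum_proj (fun _ => ∅) (fun _ => .empty)
    (fun i j _ => disjoint_bot_left) v).summable
  simpa using h.tendsto_atTop_zero

lemma proj_mul_proj_of_disjoint {s t : Set ℂ} (hs : MeasurableSet s) (ht : MeasurableSet t)
    (h : Disjoint s t) : E.proj s * E.proj t = 0 := by
  rw [← E.proj_inter s t hs ht, h.inter_eq, E.proj_empty]

lemma proj_mul_proj_of_subset {s t : Set ℂ} (hs : MeasurableSet s) (ht : MeasurableSet t)
    (h : s ⊆ t) : E.proj s * E.proj t = E.proj s := by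
  rw [← E.proj_inter s t hs ht, Set.inter_eq_left.2 h]

lemma proj_mul_proj_of_superset {s t : Set ℂ} (hs : MeasurableSet s) (ht : MeasurableSet t)
    (h : t ⊆ s) : E.proj s * E.proj t = E.proj t := by
  rw [← E.proj_inter s t hs ht, Set.inter_eq_right.2 h]

lemma sum_proj {n : ℕ} (s : Fin n → Set ℂ) (hs : ∀ i, MeasurableSet (s i))
    (hd : Pairwise fun i j => Disjoint (s i) (s j)) :
    ∑ i, E.proj (s i) = E.proj (⋃ i, s i) := by
  ext v
  let t : ℕ → Set ℂ := fun k => if h : k < n then s ⟨k, h⟩ else ∅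
  have ht : ∀ k, MeasurableSet (t k) := fun k => by
    by_cases h : k < n <;> simp [t, h, hs]
  have htd : Pairwise fun i j => Disjoint (t i) (t j) := fun i j hij => by
    by_cases hi : i < n <;> by_cases hj : j < n <;> simp [t, hi, hj]
    exact hd fun h => hij (Fin.ext_iff.1 h)
  have hU : ⋃ k, t k = ⋃ i, s i := by
    ext z
    simp only [Set.mem_iUnion]
    constructor
    · rintro ⟨k, hk⟩
      by_cases h : k < n
      · exact ⟨⟨k, h⟩, by simpa [t, h] using hk⟩
      · simp [t, h] at hk
    · rintro ⟨i, hi⟩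
      exact ⟨i, by simpa [t] using hi⟩
  have h1 := E.hasSum_proj t ht htd v
  have h2 : HasSum (fun k => E.proj (t k) v) (∑ k ∈ Finset.range n, E.proj (t k) v) :=
    hasSum_sum_of_ne_finset_zero fun k hk => by
      have : ¬ k < n := by simpa using hk
      simp [t, this, E.proj_empty]
  have h3 := h1.unique h2
  rw [hU] at h3
  rw [h3, Finset.sum_range, sum_apply]
  refine Finset.sum_congr rfl fun i _ => ?_
  simp [t]

variable {E}

lemma sum_proj_cell {R : Set ℂ} (P : TaggedPartition R) :
    ∑ i, E.proj (P.cell i) = E.proj R := by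
  rw [E.sum_proj _ P.measurableSet_cell P.pairwise_disjoint, P.iUnion_cell]

variable (E)

/-- The Riemann–Stieltjes sum `∑ᵢ λᵢ E(Δᵢ)`, which approximates the scalar part `∫ λ dE(λ)`. -/
noncomputable def stepOp {R : Set ℂ} (P : TaggedPartition R) : H →L[ℂ] H :=
  ∑ i, P.tag i • E.proj (P.cell i)

lemma stepOp_mul_proj_cell {R : Set ℂ} (P : TaggedPartition R) (i : Fin P.n) :
    E.stepOp P * E.proj (P.cell i) = P.tag i • E.proj (P.cell i) := by
  rw [stepOp, Finset.sum_mul, Finset.sum_eq_single i]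
  · rw [smul_mul_assoc, E.proj_mul_proj_of_subset (P.measurableSet_cell i) (P.measurableSet_cell i)
      subset_rfl]
  · intro j _ hj
    rw [smul_mul_assoc, E.proj_mul_proj_of_disjoint (P.measurableSet_cell j)
      (P.measurableSet_cell i) (P.pairwise_disjoint hj), smul_zero]
  · simp

end SpectralMeasure

/-! ### Growth of powers in a Banach algebra -/

lemma pow_mul_eq_pow_mul_of_mul_eq {M : Type*} [Monoid M] {a b e : M} (h : a * e = b * e)
    (hb : Commute b e) (q : ℕ) : a ^ q * e = b ^ q * e := by
  induction q with
  | zero => simp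
  | succ q ih =>
    rw [pow_succ, mul_assoc, h, hb.eq, ← mul_assoc, ih, mul_assoc, ← hb.eq, ← mul_assoc, ← pow_succ]

/-- Power growth is stable: if `‖a ^ n‖ ≤ C r ^ n` and `r < ρ`, all operators close to `a` satisfy
a bound `‖b ^ n‖ ≤ C' ρ ^ n` with a common constant. -/
lemma exists_eventually_norm_pow_le {A : Type*} [NormedRing A] [NormOneClass A] {a : A}
    {C r ρ : ℝ} (hr : 0 < r) (hrρ : r < ρ) (ha : ∀ n, ‖a ^ n‖ ≤ C * r ^ n) :
    ∃ C', ∀ᶠ b in 𝓝 a, ∀ n, ‖b ^ n‖ ≤ C' * ρ ^ n := by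
  have hρ : 0 < ρ := hr.trans hrρ
  obtain ⟨n, hn0, hn⟩ : ∃ n, 0 < n ∧ ‖a ^ n‖ < ρ ^ n := by
    have h1 : Tendsto (fun n : ℕ => C * (r / ρ) ^ n) atTop (𝓝 (C * 0)) :=
      (tendsto_pow_atTop_nhds_zero_of_lt_one (by positivity) ((div_lt_one hρ).2 hrρ)).const_mul C
    rw [mul_zero] at h1
    obtain ⟨n, h, hn⟩ := ((h1.eventually (gt_mem_nhds one_pos)).and (eventually_gt_atTop 0)).exists
    refine ⟨n, hn, (ha n).trans_lt ?_⟩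
    rwa [div_pow, ← mul_div_assoc, div_lt_one (by positivity)] at h
  set L : ℝ := max ρ (‖a‖ + 1)
  have hL1 : 1 ≤ L / ρ := (one_le_div hρ).2 (le_max_left _ _)
  refine ⟨(L / ρ) ^ n, ?_⟩
  have e1 : ∀ᶠ b in 𝓝 a, ‖b ^ n‖ < ρ ^ n :=
    ((continuous_pow n).norm.tendsto a).eventually (gt_mem_nhds hn)
  have e2 : ∀ᶠ b in 𝓝 a, ‖b‖ < ‖a‖ + 1 :=
    (continuous_norm.tendsto a).eventually (gt_mem_nhds (lt_add_one _))
  filter_upwards [e1, e2] with b hb1 hb2 k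
  have hbL : ‖b‖ ≤ L := hb2.le.trans (le_max_right _ _)
  -- divide the exponent with remainder: `k = n * (k / n) + k % n`
  have hk := Nat.div_add_mod k n
  have hL : 0 ≤ L := hρ.le.trans (le_max_left _ _)
  calc ‖b ^ k‖ = ‖(b ^ n) ^ (k / n) * b ^ (k % n)‖ := by rw [← pow_mul, ← pow_add, hk]
    _ ≤ ‖(b ^ n) ^ (k / n)‖ * ‖b ^ (k % n)‖ := norm_mul_le _ _
    _ ≤ ‖b ^ n‖ ^ (k / n) * ‖b‖ ^ (k % n) := by gcongr <;> exact norm_pow_le _ _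
    _ ≤ (ρ ^ n) ^ (k / n) * L ^ (k % n) := by gcongr
    _ = (L / ρ) ^ (k % n) * ((ρ ^ n) ^ (k / n) * ρ ^ (k % n)) := by
      rw [div_pow]; field_simp
    _ ≤ (L / ρ) ^ n * ((ρ ^ n) ^ (k / n) * ρ ^ (k % n)) := by
      gcongr ?_ * _
      exact pow_le_pow_right₀ hL1 (Nat.mod_lt _ hn0).le
    _ = (L / ρ) ^ n * ρ ^ k := by rw [← pow_mul, ← pow_add, hk]

lemma exists_norm_pow_le_of_spectralRadius_lt {A : Type*} [NormedRing A] [NormedAlgebra ℂ A]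
    [CompleteSpace A] {a : A} {r : ℝ} (hr : 0 < r) (h : spectralRadius ℂ a < ENNReal.ofReal r) :
    ∃ C, 0 ≤ C ∧ ∀ n, ‖a ^ n‖ ≤ C * r ^ n := by
  have h1 := spectrum.pow_norm_pow_one_div_tendsto_nhds_spectralRadius a
  have h2 : ∀ᶠ n : ℕ in atTop, ‖a ^ n‖ / r ^ n ≤ 1 := by
    filter_upwards [h1.eventually (gt_mem_nhds h), eventually_gt_atTop 0] with n hn hn0
    have h3 := (ENNReal.ofReal_lt_ofReal_iff hr).1 hn
    rw [div_le_one (by positivity)]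
    have h4 := pow_le_pow_left₀ (by positivity) h3.le n
    rwa [← Real.rpow_natCast, ← Real.rpow_mul (norm_nonneg _), one_div,
      inv_mul_cancel₀ (by exact_mod_cast hn0.ne'), Real.rpow_one] at h4
  obtain ⟨C, hC⟩ := (isBoundedUnder_of_eventually_le h2).bddAbove_range
  refine ⟨max C 0, le_max_right _ _, fun n => ?_⟩
  have h5 : ‖a ^ n‖ / r ^ n ≤ max C 0 := (hC ⟨n, rfl⟩).trans (le_max_left _ _)
  rwa [div_le_iff₀ (by positivity)] at h5

/-- Subtracting a commuting element of smaller growth changes the growth rate by at most the sum. -/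
lemma norm_sub_pow_le_of_commute {A : Type*} [NormedRing A] [NormedAlgebra ℂ A] {a b : A}
    (hab : Commute a b) {C D r s : ℝ} (hr : 0 ≤ r) (hC : 0 ≤ C) (ha : ∀ n, ‖a ^ n‖ ≤ C * r ^ n)
    (hb : ∀ n, ‖b ^ n‖ ≤ D * s ^ n) (n : ℕ) : ‖(a - b) ^ n‖ ≤ C * D * (r + s) ^ n := by
  have hb' : ∀ n, ‖(-b) ^ n‖ ≤ D * s ^ n := fun n => by
    rcases Nat.even_or_odd n with h | h
    · rw [h.neg_pow]; exact hb n
    · rw [h.neg_pow, norm_neg]; exact hb n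
  rw [sub_eq_add_neg, hab.neg_right.add_pow, add_pow, Finset.mul_sum]
  refine (norm_sum_le _ _).trans (Finset.sum_le_sum fun m _ => ?_)
  rw [← nsmul_eq_mul']
  refine norm_nsmul_le.trans ?_
  calc (n.choose m : ℝ) * ‖a ^ m * (-b) ^ (n - m)‖
      ≤ n.choose m * ((C * r ^ m) * (D * s ^ (n - m))) := by
        gcongr
        exact (norm_mul_le _ _).trans (mul_le_mul (ha _) (hb' _) (norm_nonneg _) (by positivity))
    _ = _ := by ring

/-! ### Riemann–Stieltjes sums of a spectral operator -/

open TaggedPartition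

section

variable {H : Type*} [NormedAddCommGroup H] [InnerProductSpace ℂ H]

lemma hasSpectralIntegral_iff_tendsto {E : SpectralMeasure H} {R : Set ℂ} {F : ℂ → H →L[ℂ] H}
    {T : H →L[ℂ] H} :
    HasSpectralIntegral E R F T ↔
      Tendsto (fun P : TaggedPartition R => ∑ i, F (P.tag i) * E.proj (P.cell i))
        (meshFilter R) (𝓝 T) := by
  rw [(meshFilter_hasBasis R).tendsto_iff Metric.nhds_basis_closedBall]
  simp only [Metric.mem_closedBall, dist_eq_norm, HasSpectralIntegral, Set.mem_ofPred_eq]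

namespace SpectralOperator

variable (X : SpectralOperator H)

/-- The Riemann–Stieltjes sum of the monomial `λ ^ k` against `(X - λ) ^ q dE(λ)`. -/
noncomputable def powSum (q k : ℕ) {R : Set ℂ} (P : TaggedPartition R) : H →L[ℂ] H :=
  ∑ i, P.tag i ^ k • X.incr q P i

variable {X}

/-- On the range of `E(Δᵢ)` the operator `S` acts as the scalar `λᵢ`, so that a Riemann–Stieltjes sum is
a polynomial in `S` and `X`. -/
lemma powSum_eq {R : Set ℂ} {P : TaggedPartition R} {S : H →L[ℂ] H}
    (hS : ∀ i, S * X.E.proj (P.cell i) = P.tag i • X.E.proj (P.cell i)) (q k : ℕ) :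
    X.powSum q k P = S ^ k * (X.op - S) ^ q * X.E.proj R := by
  have h1 : ∀ i, (X.op - S) ^ q * X.E.proj (P.cell i) =
      (X.op - P.tag i • (1 : H →L[ℂ] H)) ^ q * X.E.proj (P.cell i) := fun i => by
    apply pow_mul_eq_pow_mul_of_mul_eq
    · rw [sub_mul, sub_mul, hS, smul_mul_assoc, one_mul]
    · exact (X.commute_proj _ (P.measurableSet_cell i)).sub_left
        ((Commute.one_left _).smul_left _)
  have h2 : ∀ i, S ^ k * X.E.proj (P.cell i) = P.tag i ^ k • X.E.proj (P.cell i) := fun i => by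
    rw [pow_mul_eq_pow_mul_of_mul_eq (b := P.tag i • (1 : H →L[ℂ] H)) (by rw [hS]; simp)
      ((Commute.one_left _).smul_left _), smul_pow, one_pow, smul_mul_assoc, one_mul]
  rw [← SpectralMeasure.sum_proj_cell P, Finset.mul_sum, powSum]
  refine Finset.sum_congr rfl fun i _ => ?_
  rw [mul_assoc, h1, incr]
  have hc : Commute ((X.op - P.tag i • (1 : H →L[ℂ] H)) ^ q) (X.E.proj (P.cell i)) :=
    ((X.commute_proj _ (P.measurableSet_cell i)).sub_left
        ((Commute.one_left _).smul_left _)).pow_left q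
  rw [hc.eq, ← mul_assoc, h2, smul_mul_assoc]

lemma sum_smul_incr {R : Set ℂ} (P : TaggedPartition R) (q : ℕ) :
    ∑ i, (X.op - P.tag i • (1 : H →L[ℂ] H)) ^ q * X.E.proj (P.cell i) = X.powSum q 0 P := by
  simp [powSum, incr]

lemma order_le_iff {q : ℕ} {z : ℂ} : X.order z ≤ q ↔ ∃ k ≤ q, ∃ V : Set ℂ, IsOpen V ∧ z ∈ V ∧
    HasSpectralIntegral X.E (spectrum ℂ X.op ∩ V)
      (fun z => (X.op - z • (1 : H →L[ℂ] H)) ^ k) 0 := by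
  constructor
  · intro h
    have hne : {m : ℕ∞ | ∃ k : ℕ, m = k ∧ ∃ V : Set ℂ, IsOpen V ∧ z ∈ V ∧
        HasSpectralIntegral X.E (spectrum ℂ X.op ∩ V)
          (fun z => (X.op - z • (1 : H →L[ℂ] H)) ^ k) 0}.Nonempty := by
      by_contra hne
      rw [Set.not_nonempty_iff_eq_empty] at hne
      rw [order, hne, sInf_empty] at h
      exact absurd h (by simp)
    obtain ⟨k, hk, hV⟩ := csInf_mem hne
    refine ⟨k, ?_, hV⟩
    rw [order, hk] at h
    exact_mod_cast h
  · rintro ⟨k, hk, hV⟩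
    have h : X.order z ≤ k := sInf_le ⟨k, rfl, hV⟩
    exact h.trans (by exact_mod_cast hk)

lemma region_subset_spectrum (q : ℕ) : X.region q ⊆ spectrum ℂ X.op := fun _ h => h.1

variable [CompleteSpace H]

lemma measurableSet_spectrum : MeasurableSet (spectrum ℂ X.op) :=
  (spectrum.isClosed X.op).measurableSet

/-- The Riemann–Stieltjes sums over a part `R` of the spectrum are controlled by those over the whole
spectrum: complete the partition of `R` and multiply by `E(R)`. -/
lemma eventually_exists_powSum_eq {R : Set ℂ} (hR : MeasurableSet R) (hRσ : R ⊆ spectrum ℂ X.op)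
    {p : (H →L[ℂ] H) → Prop}
    (h : ∀ᶠ P in meshFilter (spectrum ℂ X.op), p (X.E.stepOp P)) :
    ∀ᶠ P in meshFilter R, ∃ S, p S ∧
      ∀ q k, X.powSum q k P = S ^ k * (X.op - S) ^ q * X.E.proj R := by
  obtain ⟨δ, hδ, h⟩ := (meshFilter_hasBasis _).eventually_iff.1 h
  refine (meshFilter_hasBasis _).eventually_iff.2 ⟨δ, hδ, fun P hP => ?_⟩
  obtain ⟨P', hP', hPP'⟩ := exists_extension measurableSet_spectrum
    (spectrum.isBounded X.op) hR hRσ hδ P hP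
  refine ⟨_, h hP', powSum_eq fun i => ?_⟩
  obtain ⟨j, hj, hj'⟩ := hPP' i
  rw [← hj, ← hj', SpectralMeasure.stepOp_mul_proj_cell]

lemma tendsto_powSum {R : Set ℂ} (hR : MeasurableSet R) (hRσ : R ⊆ spectrum ℂ X.op)
    {S : H →L[ℂ] H}
    (hS : Tendsto (fun P => X.E.stepOp P) (meshFilter (spectrum ℂ X.op)) (𝓝 S)) (q k : ℕ) :
    Tendsto (fun P => X.powSum q k P) (meshFilter R)
      (𝓝 (S ^ k * (X.op - S) ^ q * X.E.proj R)) := by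
  refine fun U hU => mem_map.2 ?_
  have hc : Continuous fun S : H →L[ℂ] H => S ^ k * (X.op - S) ^ q * X.E.proj R := by fun_prop
  filter_upwards [eventually_exists_powSum_eq hR hRσ (hS.eventually ((hc.tendsto S) hU))]
    with P ⟨S', hS', h⟩
  rw [Set.mem_preimage, h]
  exact hS'

variable (X) in
/-- The canonical decomposition of a spectral operator into commuting scalar and quasi-nilpotent
parts. -/
lemma exists_scalar_add_quasinilpotent :
    ∃ S : H →L[ℂ] H, Commute S X.op ∧ spectralRadius ℂ (X.op - S) = 0 ∧
      Tendsto (fun P => X.E.stepOp P) (meshFilter (spectrum ℂ X.op)) (𝓝 S) := by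
  obtain ⟨N, hN, hr⟩ := X.quasinilpotent
  have : (meshFilter (spectrum ℂ X.op)).NeBot :=
    meshFilter_neBot measurableSet_spectrum (spectrum.isBounded X.op)
  have ht : Tendsto (fun P => X.E.stepOp P) (meshFilter (spectrum ℂ X.op)) (𝓝 (X.op - N)) := by
    refine (tendsto_const_nhds.sub (hasSpectralIntegral_iff_tendsto.1 hN)).congr fun P => ?_
    simp only [sub_mul, Finset.sum_sub_distrib, ← Finset.mul_sum, smul_mul_assoc, one_mul]
    rw [SpectralMeasure.sum_proj_cell, X.proj_spectrum, mul_one, sub_sub_cancel]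
    rfl
  refine ⟨X.op - N, ?_, by rwa [sub_sub_cancel], ht⟩
  have h1 := ht.mul_const X.op
  have h2 := ht.const_mul X.op
  refine tendsto_nhds_unique h1 (h2.congr fun P => ?_)
  rw [SpectralMeasure.stepOp, Finset.mul_sum, Finset.sum_mul]
  refine Finset.sum_congr rfl fun i _ => ?_
  exact (((X.commute_proj _ (P.measurableSet_cell i)).smul_right _)).eq

lemma isClosed_region (q : ℕ) : IsClosed (X.region q) := by
  have h : IsOpen {z | X.order z ≤ q} := isOpen_iff_mem_nhds.2 fun z hz => by
    obtain ⟨k, hk, V, hV, hzV, hi⟩ := order_le_iff.1 hz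
    exact mem_of_superset (hV.mem_nhds hzV) fun w hw => order_le_iff.2 ⟨k, hk, V, hV, hw, hi⟩
  have h2 : X.region q = spectrum ℂ X.op ∩ {z | X.order z ≤ q}ᶜ := by
    ext z
    simp [region]
  rw [h2]
  exact (spectrum.isClosed _).inter h.isClosed_compl

lemma measurableSet_region (q : ℕ) : MeasurableSet (X.region q) :=
  (isClosed_region q).measurableSet

lemma meshFilter_region_neBot (q : ℕ) : (meshFilter (X.region q)).NeBot :=
  meshFilter_neBot (measurableSet_region q)
    ((spectrum.isBounded X.op).subset (region_subset_spectrum q))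

/-- The `q`-th power of the quasi-nilpotent part is carried by the points whose order exceeds `q`:
it vanishes locally near the other points, of which countably many neighbourhoods suffice. -/
lemma sub_pow_mul_proj_region {S : H →L[ℂ] H}
    (hS : Tendsto (fun P => X.E.stepOp P) (meshFilter (spectrum ℂ X.op)) (𝓝 S)) (q : ℕ) :
    (X.op - S) ^ q * X.E.proj (X.region q) = (X.op - S) ^ q := by
  set D := spectrum ℂ X.op \ X.region q
  have hDm : MeasurableSet D := measurableSet_spectrum.diff (measurableSet_region q)
  have hloc : ∀ z ∈ D, ∃ V : Set ℂ, IsOpen V ∧ z ∈ V ∧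
      (X.op - S) ^ q * X.E.proj (spectrum ℂ X.op ∩ V) = 0 := by
    rintro z ⟨hz, hzq⟩
    obtain ⟨k, hk, V, hV, hzV, hi⟩ := order_le_iff.1 (not_lt.1 fun h => hzq ⟨hz, h⟩)
    refine ⟨V, hV, hzV, ?_⟩
    have hm : MeasurableSet (spectrum ℂ X.op ∩ V) := measurableSet_spectrum.inter hV.measurableSet
    have : (meshFilter (spectrum ℂ X.op ∩ V)).NeBot :=
      meshFilter_neBot hm ((spectrum.isBounded X.op).subset Set.inter_subset_left)
    have h0 := hasSpectralIntegral_iff_tendsto.1 hi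
    simp only [sum_smul_incr] at h0
    have h1 := tendsto_nhds_unique (tendsto_powSum hm Set.inter_subset_left hS k 0) h0
    rw [pow_zero, one_mul] at h1
    rw [← Nat.sub_add_cancel hk, pow_add, mul_assoc, h1, mul_zero]
  choose! V hVo hzV hV0 using hloc
  have hD0 : (X.op - S) ^ q * X.E.proj D = 0 := by
    obtain ⟨t, htD, htc, hDt⟩ := TopologicalSpace.countable_cover_nhdsWithin
      (f := V) (s := D) fun z hz => mem_nhdsWithin_of_mem_nhds ((hVo z hz).mem_nhds (hzV z hz))
    rcases t.eq_empty_or_nonempty with rfl | htne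
    · have : D = ∅ := by simpa using hDt
      rw [this, X.E.proj_empty, mul_zero]
    obtain ⟨u, hu⟩ := htc.exists_eq_range htne
    have huD : ∀ n, u n ∈ D := fun n => htD (hu ▸ Set.mem_range_self n)
    let W : ℕ → Set ℂ := fun n => D ∩ V (u n)
    have hWm : ∀ n, MeasurableSet (W n) := fun n => hDm.inter (hVo _ (huD n)).measurableSet
    have hWU : ⋃ n, disjointed W n = D := by
      rw [iUnion_disjointed]
      refine subset_antisymm (Set.iUnion_subset fun _ => Set.inter_subset_left) fun z hz => ?_
      obtain ⟨w, hw, hzw⟩ := Set.mem_iUnion₂.1 (hDt hz)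
      rw [hu] at hw
      obtain ⟨n, rfl⟩ := hw
      exact Set.mem_iUnion.2 ⟨n, hz, hzw⟩
    ext v
    have h1 := (X.E.hasSum_proj _ (fun n => MeasurableSet.disjointed hWm n)
      (disjoint_disjointed W) v).mapL ((X.op - S) ^ q)
    rw [hWU] at h1
    have h2 : ∀ n, ((X.op - S) ^ q) (X.E.proj (disjointed W n) v) = 0 := fun n => by
      have hsub : disjointed W n ⊆ spectrum ℂ X.op ∩ V (u n) := fun z hz =>
        ⟨(disjointed_subset W n hz).1.1, (disjointed_subset W n hz).2⟩
      have h3 := X.E.proj_mul_proj_of_superset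
        (measurableSet_spectrum.inter (hVo _ (huD n)).measurableSet)
        (MeasurableSet.disjointed hWm n) hsub
      have h4 : (X.op - S) ^ q * X.E.proj (disjointed W n) = 0 := by
        rw [← h3, ← mul_assoc, hV0 _ (huD n), zero_mul]
      exact DFunLike.congr_fun h4 v
    simp only [h2] at h1
    exact h1.unique hasSum_zero
  have hsum : X.E.proj (X.region q) + X.E.proj D = 1 := by
    have h := X.E.sum_proj ![X.region q, D]
      (by intro i; fin_cases i; exacts [measurableSet_region q, hDm])
      (by
        intro i j hij
        fin_cases i <;> fin_cases j <;> first | exact absurd rfl hij | skip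
        exacts [Set.disjoint_sdiff_right, Set.disjoint_sdiff_left])
    have hU : ⋃ i, ![X.region q, D] i = spectrum ℂ X.op := by
      ext z
      simp only [Set.mem_iUnion, Fin.exists_fin_two]
      simp only [Matrix.cons_val_zero, Matrix.cons_val_one, D, Set.mem_sdiff]
      have := @region_subset_spectrum _ _ _ X q z
      tauto
    rw [hU, X.proj_spectrum, Fin.sum_univ_two] at h
    exact h
  rw [← add_zero (_ * _), ← hD0, ← mul_add, hsum, mul_one]

end SpectralOperator

end

/-! ### Integrals of monomials and uniqueness of operator integrals -/

/-- The `q`-th Taylor coefficient of the monomial `z ^ k` at `z`. -/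
noncomputable def monomialJet (q k : ℕ) (z : ℂ) : ℂ := (k.choose q : ℂ) * z ^ (k - q)

lemma choose_mul_pow_mul_pow_le {r ε : ℝ} (hr : 0 ≤ r) (hε : 0 ≤ ε) (q k : ℕ) :
    (k.choose q : ℝ) * r ^ (k - q) * ε ^ q ≤ (r + ε) ^ k := by
  rcases le_or_gt q k with h | h
  · rw [add_comm, add_pow]
    refine le_trans (le_of_eq ?_) (Finset.single_le_sum
      (f := fun m => ε ^ m * r ^ (k - m) * (k.choose m : ℝ)) (fun m _ => by positivity)
      (Finset.mem_range.2 (Nat.lt_succ_of_le h)))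
    ring
  · rw [Nat.choose_eq_zero_of_lt h]
    simp only [Nat.cast_zero, zero_mul]
    positivity

lemma hasSum_choose_mul_pow {A : Type*} [Semiring A] [TopologicalSpace A] {a b : A}
    (h : Commute a b) (k : ℕ) : HasSum (fun q => (k.choose q) • (a ^ (k - q) * b ^ q)) ((a + b) ^ k) := by
  rw [add_comm, h.symm.add_pow]
  have h1 := hasSum_sum_of_ne_finset_zero (L := SummationFilter.unconditional ℕ)
    (s := Finset.range (k + 1))
    (f := fun q => (k.choose q) • (a ^ (k - q) * b ^ q)) fun q hq => by
      rw [Nat.choose_eq_zero_of_lt (by simpa using hq), zero_smul]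
  convert h1 using 1
  refine Finset.sum_congr rfl fun q _ => ?_
  rw [nsmul_eq_mul', (h.pow_pow _ _).eq]

/-- What is needed from a spectral operator `X = S + N` in order to integrate power series: the
operators `∫ (z ^ k)^{(q)} / q! (X - z) ^ q dE(z) = (k choose q) S ^ (k - q) N ^ q`, their sum
`X ^ k` over `q`, and bounds of the order `ρ ^ k` for them and for the Riemann–Stieltjes sums
converging to them. -/
structure JetExpansion {H : Type*} [NormedAddCommGroup H] [InnerProductSpace ℂ H]
    (X : SpectralOperator H) (ρ : ℝ) where
  /-- the integral of the `q`-th Taylor coefficient of `z ^ k` -/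
  jet : ℕ → ℕ → H →L[ℂ] H
  /-- a bound for the norm of `jet q k` -/
  bound : ℕ → ℕ → ℝ
  /-- the constant in the bound for `∑ q, bound q k` -/
  const : ℝ
  norm_jet_le : ∀ q k, ‖jet q k‖ ≤ bound q k
  hasSum_bound : ∀ k, HasSum (fun q => bound q k) (const * ρ ^ k)
  hasSum_jet : ∀ k, HasSum (fun q => jet q k) (X.op ^ k)
  tendsto_jet : ∀ q k, Tendsto
    (fun P : TaggedPartition (X.region q) => ∑ i, monomialJet q k (P.tag i) • X.incr q P i)
    (meshFilter (X.region q)) (𝓝 (jet q k))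
  eventually_norm_le : ∀ q, ∃ C, ∀ᶠ P : TaggedPartition (X.region q) in meshFilter (X.region q),
    ∀ k, ‖∑ i, monomialJet q k (P.tag i) • X.incr q P i‖ ≤ C * ρ ^ k

section

variable {H : Type*} [NormedAddCommGroup H] [InnerProductSpace ℂ H] [CompleteSpace H]

lemma SpectralOperator.nonempty_jetExpansion [Nontrivial H] (X : SpectralOperator H) {ρ : ℝ}
    (hρ : spectralRadius ℂ X.op < ENNReal.ofReal ρ) : Nonempty (JetExpansion X ρ) := by
  obtain ⟨S, hc, hN, hS⟩ := X.exists_scalar_add_quasinilpotent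
  set N := X.op - S
  have hρ0 : 0 < ρ := ENNReal.ofReal_pos.1 (bot_le.trans_lt hρ)
  -- radii `r₀ < r₀ + ε < r₀ + 2ε < ρ` for `X`, `S` and the step operators approximating `S`
  obtain ⟨r₀, hr₀, hXr, hrρ⟩ :
      ∃ r₀ : ℝ, 0 < r₀ ∧ spectralRadius ℂ X.op < ENNReal.ofReal r₀ ∧ r₀ < ρ := by
    obtain ⟨r₀, h1, h2⟩ := exists_between hρ
    have htop : r₀ ≠ ⊤ := h2.ne_top
    refine ⟨r₀.toReal, ENNReal.toReal_pos (bot_le.trans_lt h1).ne' htop,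
      by rwa [ENNReal.ofReal_toReal htop], ?_⟩
    rw [← ENNReal.ofReal_toReal htop] at h2
    exact (ENNReal.ofReal_lt_ofReal_iff hρ0).1 h2
  set ε := (ρ - r₀) / 3 with hε
  have hε0 : 0 < ε := by rw [hε]; linarith
  set r := r₀ + ε + ε with hr
  have hr0 : 0 < r := by positivity
  have hrε : r + ε = ρ := by rw [hr, hε]; ring
  obtain ⟨C₁, hC₁, hXpow⟩ := exists_norm_pow_le_of_spectralRadius_lt hr₀ hXr
  obtain ⟨C₂, hC₂, hNpow⟩ := exists_norm_pow_le_of_spectralRadius_lt (a := N) hε0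
    (by rw [hN]; exact ENNReal.ofReal_pos.2 hε0)
  have hcN : Commute X.op N := (Commute.refl _).sub_right hc.symm
  have hSN : Commute S N := hc.sub_right (Commute.refl _)
  have hSpow : ∀ n, ‖S ^ n‖ ≤ C₁ * C₂ * (r₀ + ε) ^ n := fun n => by
    have := norm_sub_pow_le_of_commute hcN hr₀.le hC₁ hXpow hNpow n
    rwa [sub_sub_cancel] at this
  obtain ⟨C₃, hstep⟩ := exists_eventually_norm_pow_le (ρ := r) (by positivity)
    (by rw [hr]; linarith) hSpow
  have hSpow' : ∀ n, ‖S ^ n‖ ≤ C₁ * C₂ * r ^ n := fun n => (hSpow n).trans (by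
    gcongr; rw [hr]; linarith)
  have hsum : ∀ q k {R : Set ℂ} (P : TaggedPartition R),
      ∑ i, monomialJet q k (P.tag i) • X.incr q P i = (k.choose q : ℂ) • X.powSum q (k - q) P :=
    fun q k R P => by
      rw [SpectralOperator.powSum, Finset.smul_sum]
      refine Finset.sum_congr rfl fun i _ => ?_
      rw [monomialJet, mul_smul]
  refine ⟨⟨fun q k => (k.choose q : ℂ) • (S ^ (k - q) * N ^ q),
    fun q k => C₁ * C₂ * C₂ * (k.choose q • (r ^ (k - q) * ε ^ q)),
    C₁ * C₂ * C₂, ?_, ?_, ?_, ?_, ?_⟩⟩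
  · intro q k
    rw [norm_smul, Complex.norm_natCast, nsmul_eq_mul]
    calc (k.choose q : ℝ) * ‖S ^ (k - q) * N ^ q‖
        ≤ k.choose q * ((C₁ * C₂ * r ^ (k - q)) * (C₂ * ε ^ q)) := by
          gcongr
          exact (norm_mul_le _ _).trans
            (mul_le_mul (hSpow' _) (hNpow _) (norm_nonneg _) (by positivity))
      _ = _ := by ring
  · intro k
    rw [← hrε]
    exact (hasSum_choose_mul_pow (Commute.all r ε) k).mul_left _
  · intro k
    have h := hasSum_choose_mul_pow hSN k
    rw [add_sub_cancel] at h
    simpa only [Nat.cast_smul_eq_nsmul] using h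
  · intro q k
    simp only [hsum]
    have h := SpectralOperator.tendsto_powSum (SpectralOperator.measurableSet_region q)
      (SpectralOperator.region_subset_spectrum q) hS q (k - q)
    rw [mul_assoc, SpectralOperator.sub_pow_mul_proj_region hS] at h
    exact h.const_smul _
  · intro q
    -- the factors `(X - S') ^ q E(region)` stay bounded, since `S'` converges
    have hcont : Continuous fun S' : H →L[ℂ] H =>
      ‖(X.op - S') ^ q * X.E.proj (X.region q)‖ := by fun_prop
    set D := ‖(X.op - S) ^ q * X.E.proj (X.region q)‖ + 1
    have hD : 0 ≤ D := by positivity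
    have hev := hS.eventually (hstep.and
      ((hcont.tendsto S).eventually (gt_mem_nhds (lt_add_one _))))
    refine ⟨|C₃| * D / ε ^ q, ?_⟩
    filter_upwards [SpectralOperator.eventually_exists_powSum_eq
      (p := fun S' => (∀ n, ‖S' ^ n‖ ≤ C₃ * r ^ n) ∧
        ‖(X.op - S') ^ q * X.E.proj (X.region q)‖ < D)
      (SpectralOperator.measurableSet_region q)
      (SpectralOperator.region_subset_spectrum q) hev] with P hP k
    obtain ⟨S', ⟨hS'1, hS'2⟩, hP⟩ := hP
    rw [hsum, norm_smul, Complex.norm_natCast, hP, mul_assoc]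
    calc (k.choose q : ℝ) * ‖S' ^ (k - q) * ((X.op - S') ^ q * X.E.proj (X.region q))‖
        ≤ k.choose q * ((|C₃| * r ^ (k - q)) * D) := by
          gcongr
          refine (norm_mul_le _ _).trans
            (mul_le_mul ((hS'1 _).trans ?_) hS'2.le (norm_nonneg _) (by positivity))
          gcongr
          exact le_abs_self _
      _ = |C₃| * D / ε ^ q * (k.choose q * r ^ (k - q) * ε ^ q) := by field_simp
      _ ≤ |C₃| * D / ε ^ q * ρ ^ k := by
          gcongr
          rw [← hrε]
          exact choose_mul_pow_mul_pow_le hr0.le hε0.le q k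

/-- Interchange of summations for a weighted family of absolutely convergent series. -/
lemma hasSum_tsum_smul_of_bound {V K Q : Type*} [NormedAddCommGroup V] [NormedSpace ℂ V]
    [CompleteSpace V] {c : K → ℂ} {G : K → Q → V} {g : K → Q → ℝ}
    {b : K → ℝ} {t : K → V} (hG : ∀ k q, ‖G k q‖ ≤ g k q) (hg : ∀ k, HasSum (g k) (b k))
    (hb : Summable fun k => ‖c k‖ * b k) (ht : ∀ k, HasSum (G k) (t k)) :
    HasSum (fun q => ∑' k, c k • G k q) (∑' k, c k • t k) := by
  have hg0 : ∀ k q, 0 ≤ g k q := fun k q => (norm_nonneg _).trans (hG k q)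
  have h1 : Summable fun p : K × Q => ‖c p.1‖ * g p.1 p.2 := by
    refine (summable_prod_of_nonneg fun p => mul_nonneg (norm_nonneg _) (hg0 _ _)).2
      ⟨fun k => ?_, ?_⟩
    · exact (hg k).summable.mul_left ‖c k‖
    · refine hb.congr fun k => ?_
      exact (((hg k).mul_left ‖c k‖).tsum_eq).symm
  have h2 : Summable fun p : K × Q => c p.1 • G p.1 p.2 :=
    .of_norm_bounded h1 fun p => by
      rw [norm_smul]
      exact mul_le_mul_of_nonneg_left (hG _ _) (norm_nonneg _)
  have h3 : ∑' k, c k • t k = ∑' p : K × Q, c p.1 • G p.1 p.2 :=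
    (h2.hasSum.prod_fiberwise fun k => (ht k).const_smul (c k)).tsum_eq
  rw [h3]
  have h4 := h2.prod_symm
  have h5 := h4.hasSum.prod_fiberwise fun q => (h4.prod_factor q).hasSum
  have h6 : ∑' p : Q × K, c p.swap.1 • G p.swap.1 p.swap.2 = ∑' p : K × Q, c p.1 • G p.1 p.2 :=
    (Equiv.prodComm Q K).tsum_eq fun p : K × Q => c p.1 • G p.1 p.2
  rw [h6] at h5
  exact h5

end

section

variable {H : Type*} [NormedAddCommGroup H] [InnerProductSpace ℂ H]

lemma hasDoubleIntegral_iff_tendsto {g : ℂ → ℂ → ℂ} {q₁ q₂ : ℕ} {X₁ X₂ : SpectralOperator H}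
    {Y T : H →L[ℂ] H} : HasDoubleIntegral g q₁ q₂ X₁ X₂ Y T ↔
      Tendsto (fun P : TaggedPartition (X₁.region q₁) × TaggedPartition (X₂.region q₂) =>
        ∑ i, ∑ j, g (P.1.tag i) (P.2.tag j) • (X₁.incr q₁ P.1 i * Y * X₂.incr q₂ P.2 j))
        (meshFilter (X₁.region q₁) ×ˢ meshFilter (X₂.region q₂)) (𝓝 T) := by
  rw [((meshFilter_hasBasis _).prod (meshFilter_hasBasis _)).tendsto_iff
    Metric.nhds_basis_closedBall]
  simp only [Metric.mem_closedBall, dist_eq_norm, HasDoubleIntegral]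
  refine forall₂_congr fun ε _ => ⟨?_, ?_⟩
  · rintro ⟨δ, hδ, h⟩
    exact ⟨(δ, δ), ⟨hδ, hδ⟩, fun P hP => h _ _ hP.1 hP.2⟩
  · rintro ⟨δ, hδ, h⟩
    exact ⟨min δ.1 δ.2, lt_min hδ.1 hδ.2, fun P₁ P₂ h₁ h₂ =>
      h (P₁, P₂) ⟨h₁.mono (min_le_left _ _), h₂.mono (min_le_right _ _)⟩⟩

lemma hasTripleIntegral_iff_tendsto {g : ℂ → ℂ → ℂ → ℂ} {q₁ q₂ q₃ : ℕ}
    {X₁ X₂ X₃ : SpectralOperator H} {Y₁ Y₂ T : H →L[ℂ] H} :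
    HasTripleIntegral g q₁ q₂ q₃ X₁ X₂ X₃ Y₁ Y₂ T ↔
      Tendsto (fun P : TaggedPartition (X₁.region q₁) × TaggedPartition (X₂.region q₂) ×
          TaggedPartition (X₃.region q₃) =>
        ∑ i, ∑ j, ∑ k, g (P.1.tag i) (P.2.1.tag j) (P.2.2.tag k) •
          (X₁.incr q₁ P.1 i * Y₁ * X₂.incr q₂ P.2.1 j * Y₂ * X₃.incr q₃ P.2.2 k))
        (meshFilter (X₁.region q₁) ×ˢ meshFilter (X₂.region q₂) ×ˢ meshFilter (X₃.region q₃))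
        (𝓝 T) := by
  rw [((meshFilter_hasBasis _).prod ((meshFilter_hasBasis _).prod
    (meshFilter_hasBasis _))).tendsto_iff Metric.nhds_basis_closedBall]
  simp only [Metric.mem_closedBall, dist_eq_norm, HasTripleIntegral]
  refine forall₂_congr fun ε _ => ⟨?_, ?_⟩
  · rintro ⟨δ, hδ, h⟩
    exact ⟨(δ, δ, δ), ⟨hδ, hδ, hδ⟩, fun P hP => h _ _ _ hP.1 hP.2.1 hP.2.2⟩
  · rintro ⟨δ, hδ, h⟩
    exact ⟨min δ.1 (min δ.2.1 δ.2.2), lt_min hδ.1 (lt_min hδ.2.1 hδ.2.2), fun P₁ P₂ P₃ h₁ h₂ h₃ =>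
      h (P₁, P₂, P₃) ⟨h₁.mono (min_le_left _ _),
        h₂.mono ((min_le_right _ _).trans (min_le_left _ _)),
        h₃.mono ((min_le_right _ _).trans (min_le_right _ _))⟩⟩

end

section

variable {H : Type*} [NormedAddCommGroup H] [InnerProductSpace ℂ H] [CompleteSpace H]

lemma IsGDOI.unique {β : ℂ → ℂ → ℂ} {X₁ X₂ : SpectralOperator H} {Y T T' : H →L[ℂ] H}
    (h : IsGDOI β X₁ X₂ Y T) (h' : IsGDOI β X₁ X₂ Y T') : T = T' := by
  obtain ⟨I, hI, hT⟩ := h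
  obtain ⟨I', hI', hT'⟩ := h'
  have hII' : I = I' := by
    funext ⟨q₁, q₂⟩
    have := X₁.meshFilter_region_neBot q₁
    have := X₂.meshFilter_region_neBot q₂
    exact tendsto_nhds_unique (hasDoubleIntegral_iff_tendsto.1 (hI q₁ q₂))
      (hasDoubleIntegral_iff_tendsto.1 (hI' q₁ q₂))
  subst hII'
  exact hT.unique hT'

lemma IsGTOI.unique {β : ℂ → ℂ → ℂ → ℂ} {X₁ X₂ X₃ : SpectralOperator H} {Y₁ Y₂ T T' : H →L[ℂ] H}
    (h : IsGTOI β X₁ X₂ X₃ Y₁ Y₂ T) (h' : IsGTOI β X₁ X₂ X₃ Y₁ Y₂ T') : T = T' := by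
  obtain ⟨I, hI, hT⟩ := h
  obtain ⟨I', hI', hT'⟩ := h'
  have hII' : I = I' := by
    funext ⟨q₁, q₂, q₃⟩
    have := X₁.meshFilter_region_neBot q₁
    have := X₂.meshFilter_region_neBot q₂
    have := X₃.meshFilter_region_neBot q₃
    exact tendsto_nhds_unique (hasTripleIntegral_iff_tendsto.1 (hI q₁ q₂ q₃))
      (hasTripleIntegral_iff_tendsto.1 (hI' q₁ q₂ q₃))
  subst hII'
  exact hT.unique hT'

lemma IsGDOI.gdoi_eq {β : ℂ → ℂ → ℂ} {X₁ X₂ : SpectralOperator H} {Y T : H →L[ℂ] H}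
    (h : IsGDOI β X₁ X₂ Y T) : gdoi β X₁ X₂ Y = T := by
  have hex : ∃ T, IsGDOI β X₁ X₂ Y T := ⟨T, h⟩
  rw [gdoi, dif_pos hex]
  exact hex.choose_spec.unique h

lemma IsGTOI.gtoi_eq {β : ℂ → ℂ → ℂ → ℂ} {X₁ X₂ X₃ : SpectralOperator H} {Y₁ Y₂ T : H →L[ℂ] H}
    (h : IsGTOI β X₁ X₂ X₃ Y₁ Y₂ T) : gtoi β X₁ X₂ X₃ Y₁ Y₂ = T := by
  have hex : ∃ T, IsGTOI β X₁ X₂ X₃ Y₁ Y₂ T := ⟨T, h⟩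
  rw [gtoi, dif_pos hex]
  exact hex.choose_spec.unique h

end

/-! ### Operator integrals of power series -/

lemma HasSum.mul_of_nonneg_of_nonneg {ι κ : Type*} {f : ι → ℝ} {g : κ → ℝ} {a b : ℝ}
    (hf : HasSum f a) (hg : HasSum g b) (hf0 : ∀ i, 0 ≤ f i) (hg0 : ∀ i, 0 ≤ g i) :
    HasSum (fun p : ι × κ => f p.1 * g p.2) (a * b) :=
  hf.mul hg (hf.summable.mul_of_nonneg hg.summable hf0 hg0)

lemma HasSum.mul_of_norm_le {A ι κ : Type*} [NormedRing A] [CompleteSpace A] {f : ι → A} {g : κ → A}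
    {F : ι → ℝ} {G : κ → ℝ} {s t : A} (hf : HasSum f s) (hg : HasSum g t)
    (hfF : ∀ i, ‖f i‖ ≤ F i) (hgG : ∀ i, ‖g i‖ ≤ G i) (hF : Summable F) (hG : Summable G) :
    HasSum (fun p : ι × κ => f p.1 * g p.2) (s * t) :=
  hf.mul hg (.of_norm_bounded (hF.mul_of_nonneg hG (fun i => (norm_nonneg _).trans (hfF i))
    fun i => (norm_nonneg _).trans (hgG i)) fun _ => norm_mul_le_of_le (hfF _) (hgG _))

section

variable {H : Type*} [NormedAddCommGroup H] [InnerProductSpace ℂ H]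

lemma JetExpansion.bound_nonneg {X : SpectralOperator H} {ρ : ℝ} (J : JetExpansion X ρ) (q k : ℕ) :
    0 ≤ J.bound q k := (norm_nonneg _).trans (J.norm_jet_le q k)

/-- A function given by a power series near the product of the spectra has a double operator
integral, namely the same series in the two operators. -/
lemma isGDOI_tsum [CompleteSpace H] {X₁ X₂ : SpectralOperator H} {ρ : ℝ} (J₁ : JetExpansion X₁ ρ)
    (J₂ : JetExpansion X₂ ρ) (Y : H →L[ℂ] H) {β : ℂ → ℂ → ℂ} {c : ℕ × ℕ → ℂ}
    (hc : Summable fun p => ‖c p‖ * (ρ ^ p.1 * ρ ^ p.2))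
    (hβ : ∀ q₁ q₂, ∀ x ∈ spectrum ℂ X₁.op, ∀ y ∈ spectrum ℂ X₂.op,
      HasSum (fun p => c p * (monomialJet q₁ p.1 x * monomialJet q₂ p.2 y))
        (taylorCoeff₂ β q₁ q₂ x y)) :
    IsGDOI β X₁ X₂ Y (∑' p, c p • (X₁.op ^ p.1 * (Y * X₂.op ^ p.2))) := by
  refine ⟨fun q => ∑' p, c p • (J₁.jet q.1 p.1 * (Y * J₂.jet q.2 p.2)), fun q₁ q₂ => ?_, ?_⟩
  · rw [hasDoubleIntegral_iff_tendsto]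
    obtain ⟨C₁, hC₁⟩ := J₁.eventually_norm_le q₁
    obtain ⟨C₂, hC₂⟩ := J₂.eventually_norm_le q₂
    -- the double Riemann–Stieltjes sum of a monomial is a product of single ones
    have hexp : ∀ P : TaggedPartition (X₁.region q₁) × TaggedPartition (X₂.region q₂),
        ∑' p, c p • ((∑ i, monomialJet q₁ p.1 (P.1.tag i) • X₁.incr q₁ P.1 i) *
          (Y * ∑ j, monomialJet q₂ p.2 (P.2.tag j) • X₂.incr q₂ P.2 j)) =
        ∑ i, ∑ j, taylorCoeff₂ β q₁ q₂ (P.1.tag i) (P.2.tag j) •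
          (X₁.incr q₁ P.1 i * Y * X₂.incr q₂ P.2 j) := fun P => by
      refine HasSum.tsum_eq ?_
      have h := hasSum_sum (s := Finset.univ) fun i _ => hasSum_sum (s := Finset.univ) fun j _ =>
        (hβ q₁ q₂ (P.1.tag i) (P.1.tag_mem_region i).1 (P.2.tag j)
          (P.2.tag_mem_region j).1).smul_const (X₁.incr q₁ P.1 i * Y * X₂.incr q₂ P.2 j)
      refine h.congr_fun fun p => ?_
      rw [Finset.sum_mul, Finset.smul_sum]
      refine Finset.sum_congr rfl fun i _ => ?_
      rw [Finset.mul_sum, Finset.mul_sum, Finset.smul_sum]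
      refine Finset.sum_congr rfl fun j _ => ?_
      simp only [smul_mul_assoc, mul_smul_comm, smul_smul, mul_assoc]
      congr 1
      ring
    refine Tendsto.congr hexp (tendsto_tsum_of_dominated_convergence
      (bound := fun p => ‖c p‖ * (ρ ^ p.1 * ρ ^ p.2) * (C₁ * ‖Y‖ * C₂)) (hc.mul_right _) ?_ ?_)
    · intro p
      exact ((((J₁.tendsto_jet q₁ p.1).comp tendsto_fst).mul
        (((J₂.tendsto_jet q₂ p.2).comp tendsto_snd).const_mul Y))).const_smul _
    · filter_upwards [tendsto_fst.eventually hC₁, tendsto_snd.eventually hC₂] with P h₁ h₂ p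
      rw [norm_smul]
      calc _ ≤ ‖c p‖ * ((C₁ * ρ ^ p.1) * (‖Y‖ * (C₂ * ρ ^ p.2))) := by
            gcongr
            exact norm_mul_le_of_le (h₁ _) (norm_mul_le_of_le le_rfl (h₂ _))
        _ = _ := by ring
  · refine hasSum_tsum_smul_of_bound
      (g := fun p q => J₁.bound q.1 p.1 * (‖Y‖ * J₂.bound q.2 p.2))
      (b := fun p => J₁.const * ρ ^ p.1 * (‖Y‖ * (J₂.const * ρ ^ p.2))) ?_ ?_ ?_ ?_
    · intro p q
      exact norm_mul_le_of_le (J₁.norm_jet_le _ _) (norm_mul_le_of_le le_rfl (J₂.norm_jet_le _ _))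
    · intro p
      exact (J₁.hasSum_bound p.1).mul_of_nonneg_of_nonneg ((J₂.hasSum_bound p.2).mul_left _)
        (fun _ => J₁.bound_nonneg _ _) fun _ => mul_nonneg (norm_nonneg _) (J₂.bound_nonneg _ _)
    · refine (hc.mul_right (J₁.const * (‖Y‖ * J₂.const))).congr fun p => ?_
      ring
    · intro p
      exact HasSum.mul_of_norm_le (f := fun q => J₁.jet q p.1) (g := fun q => Y * J₂.jet q p.2)
        (J₁.hasSum_jet p.1) ((J₂.hasSum_jet p.2).mul_left Y)
        (fun q => J₁.norm_jet_le q p.1)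
        (fun q => norm_mul_le_of_le le_rfl (J₂.norm_jet_le q p.2))
        (J₁.hasSum_bound p.1).summable ((J₂.hasSum_bound p.2).summable.mul_left _)

/-- A function given by a power series near the product of the spectra has a triple operator
integral, namely the same series in the three operators. -/
lemma isGTOI_tsum [CompleteSpace H] {X₁ X₂ X₃ : SpectralOperator H} {ρ : ℝ}
    (J₁ : JetExpansion X₁ ρ) (J₂ : JetExpansion X₂ ρ) (J₃ : JetExpansion X₃ ρ)
    (Y₁ Y₂ : H →L[ℂ] H) {β : ℂ → ℂ → ℂ → ℂ} {c : ℕ × ℕ × ℕ → ℂ}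
    (hc : Summable fun p => ‖c p‖ * (ρ ^ p.1 * (ρ ^ p.2.1 * ρ ^ p.2.2)))
    (hβ : ∀ q₁ q₂ q₃, ∀ x ∈ spectrum ℂ X₁.op, ∀ y ∈ spectrum ℂ X₂.op, ∀ z ∈ spectrum ℂ X₃.op,
      HasSum (fun p => c p * (monomialJet q₁ p.1 x * (monomialJet q₂ p.2.1 y *
        monomialJet q₃ p.2.2 z))) (taylorCoeff₃ β q₁ q₂ q₃ x y z)) :
    IsGTOI β X₁ X₂ X₃ Y₁ Y₂
      (∑' p, c p • (X₁.op ^ p.1 * (Y₁ * (X₂.op ^ p.2.1 * (Y₂ * X₃.op ^ p.2.2))))) := by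
  refine ⟨fun q => ∑' p, c p • (J₁.jet q.1 p.1 * (Y₁ * (J₂.jet q.2.1 p.2.1 *
    (Y₂ * J₃.jet q.2.2 p.2.2)))), fun q₁ q₂ q₃ => ?_, ?_⟩
  · rw [hasTripleIntegral_iff_tendsto]
    obtain ⟨C₁, hC₁⟩ := J₁.eventually_norm_le q₁
    obtain ⟨C₂, hC₂⟩ := J₂.eventually_norm_le q₂
    obtain ⟨C₃, hC₃⟩ := J₃.eventually_norm_le q₃
    -- the triple Riemann–Stieltjes sum of a monomial is a product of single ones
    have hexp : ∀ P : TaggedPartition (X₁.region q₁) × TaggedPartition (X₂.region q₂) ×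
          TaggedPartition (X₃.region q₃),
        ∑' p, c p • ((∑ i, monomialJet q₁ p.1 (P.1.tag i) • X₁.incr q₁ P.1 i) *
          (Y₁ * ((∑ j, monomialJet q₂ p.2.1 (P.2.1.tag j) • X₂.incr q₂ P.2.1 j) *
          (Y₂ * ∑ k, monomialJet q₃ p.2.2 (P.2.2.tag k) • X₃.incr q₃ P.2.2 k)))) =
        ∑ i, ∑ j, ∑ k, taylorCoeff₃ β q₁ q₂ q₃ (P.1.tag i) (P.2.1.tag j) (P.2.2.tag k) •
          (X₁.incr q₁ P.1 i * Y₁ * X₂.incr q₂ P.2.1 j * Y₂ * X₃.incr q₃ P.2.2 k) := fun P => by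
      refine HasSum.tsum_eq ?_
      have h := hasSum_sum (s := Finset.univ) fun i _ => hasSum_sum (s := Finset.univ) fun j _ =>
        hasSum_sum (s := Finset.univ) fun k _ =>
        (hβ q₁ q₂ q₃ (P.1.tag i) (P.1.tag_mem_region i).1 (P.2.1.tag j)
          (P.2.1.tag_mem_region j).1 (P.2.2.tag k) (P.2.2.tag_mem_region k).1).smul_const
            (X₁.incr q₁ P.1 i * Y₁ * X₂.incr q₂ P.2.1 j * Y₂ * X₃.incr q₃ P.2.2 k)
      refine h.congr_fun fun p => ?_
      rw [Finset.sum_mul, Finset.smul_sum]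
      refine Finset.sum_congr rfl fun i _ => ?_
      rw [Finset.sum_mul, Finset.mul_sum, Finset.mul_sum, Finset.smul_sum]
      refine Finset.sum_congr rfl fun j _ => ?_
      rw [Finset.mul_sum, Finset.mul_sum, Finset.mul_sum, Finset.mul_sum, Finset.smul_sum]
      refine Finset.sum_congr rfl fun k _ => ?_
      simp only [smul_mul_assoc, mul_smul_comm, smul_smul, mul_assoc]
      congr 1
      ring
    refine Tendsto.congr hexp (tendsto_tsum_of_dominated_convergence
      (bound := fun p => ‖c p‖ * (ρ ^ p.1 * (ρ ^ p.2.1 * ρ ^ p.2.2)) *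
        (C₁ * ‖Y₁‖ * C₂ * ‖Y₂‖ * C₃)) (hc.mul_right _) ?_ ?_)
    · intro p
      have t₁ := (J₁.tendsto_jet q₁ p.1).comp (tendsto_fst (g := meshFilter (X₂.region q₂) ×ˢ
        meshFilter (X₃.region q₃)))
      have t₂ := ((J₂.tendsto_jet q₂ p.2.1).comp (tendsto_fst (g := meshFilter (X₃.region q₃)))).comp
        (tendsto_snd (f := meshFilter (X₁.region q₁)))
      have t₃ := ((J₃.tendsto_jet q₃ p.2.2).comp (tendsto_snd (f := meshFilter (X₂.region q₂)))).comp
        (tendsto_snd (f := meshFilter (X₁.region q₁)))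
      exact (t₁.mul ((t₂.mul (t₃.const_mul Y₂)).const_mul Y₁)).const_smul _
    · filter_upwards [tendsto_fst.eventually hC₁, tendsto_snd.eventually
        (tendsto_fst.eventually hC₂), tendsto_snd.eventually (tendsto_snd.eventually hC₃)] with P h₁ h₂ h₃ p
      rw [norm_smul]
      calc _ ≤ ‖c p‖ * ((C₁ * ρ ^ p.1) * (‖Y₁‖ * ((C₂ * ρ ^ p.2.1) *
              (‖Y₂‖ * (C₃ * ρ ^ p.2.2))))) := by
            gcongr
            exact norm_mul_le_of_le (h₁ _) (norm_mul_le_of_le le_rfl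
              (norm_mul_le_of_le (h₂ _) (norm_mul_le_of_le le_rfl (h₃ _))))
        _ = _ := by ring
  · have hb₂₃ : ∀ p₂ p₃, HasSum
        (fun q : ℕ × ℕ => J₂.bound q.1 p₂ * (‖Y₂‖ * J₃.bound q.2 p₃))
        (J₂.const * ρ ^ p₂ * (‖Y₂‖ * (J₃.const * ρ ^ p₃))) := fun p₂ p₃ =>
      (J₂.hasSum_bound p₂).mul_of_nonneg_of_nonneg ((J₃.hasSum_bound p₃).mul_left _)
        (fun _ => J₂.bound_nonneg _ _) fun _ => mul_nonneg (norm_nonneg _) (J₃.bound_nonneg _ _)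
    have hj₂₃ : ∀ p₂ p₃, HasSum
        (fun q : ℕ × ℕ => J₂.jet q.1 p₂ * (Y₂ * J₃.jet q.2 p₃))
        (X₂.op ^ p₂ * (Y₂ * X₃.op ^ p₃)) := fun p₂ p₃ =>
      HasSum.mul_of_norm_le (f := fun q => J₂.jet q p₂) (g := fun q => Y₂ * J₃.jet q p₃)
        (J₂.hasSum_jet p₂) ((J₃.hasSum_jet p₃).mul_left Y₂)
        (fun q => J₂.norm_jet_le q p₂)
        (fun q => norm_mul_le_of_le le_rfl (J₃.norm_jet_le q p₃))
        (J₂.hasSum_bound p₂).summable ((J₃.hasSum_bound p₃).summable.mul_left _)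
    have hn₂₃ : ∀ p₂ p₃ (q : ℕ × ℕ), ‖Y₁ * (J₂.jet q.1 p₂ * (Y₂ * J₃.jet q.2 p₃))‖ ≤
        ‖Y₁‖ * (J₂.bound q.1 p₂ * (‖Y₂‖ * J₃.bound q.2 p₃)) := fun p₂ p₃ q =>
      norm_mul_le_of_le le_rfl (norm_mul_le_of_le (J₂.norm_jet_le _ _)
        (norm_mul_le_of_le le_rfl (J₃.norm_jet_le _ _)))
    refine hasSum_tsum_smul_of_bound
      (g := fun p q => J₁.bound q.1 p.1 * (‖Y₁‖ * (J₂.bound q.2.1 p.2.1 *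
        (‖Y₂‖ * J₃.bound q.2.2 p.2.2))))
      (b := fun p => J₁.const * ρ ^ p.1 * (‖Y₁‖ * (J₂.const * ρ ^ p.2.1 *
        (‖Y₂‖ * (J₃.const * ρ ^ p.2.2))))) ?_ ?_ ?_ ?_
    · intro p q
      exact norm_mul_le_of_le (J₁.norm_jet_le _ _) (hn₂₃ _ _ _)
    · intro p
      exact (J₁.hasSum_bound p.1).mul_of_nonneg_of_nonneg ((hb₂₃ p.2.1 p.2.2).mul_left _)
        (fun _ => J₁.bound_nonneg _ _) fun q => (norm_nonneg _).trans (hn₂₃ _ _ q)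
    · refine (hc.mul_right (J₁.const * ‖Y₁‖ * J₂.const * ‖Y₂‖ * J₃.const)).congr fun p => ?_
      ring
    · intro p
      exact HasSum.mul_of_norm_le (f := fun q => J₁.jet q p.1)
        (g := fun q : ℕ × ℕ => Y₁ * (J₂.jet q.1 p.2.1 * (Y₂ * J₃.jet q.2 p.2.2)))
        (J₁.hasSum_jet p.1) ((hj₂₃ p.2.1 p.2.2).mul_left Y₁)
        (fun q => J₁.norm_jet_le q p.1) (hn₂₃ _ _)
        (J₁.hasSum_bound p.1).summable ((hb₂₃ p.2.1 p.2.2).summable.mul_left _)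

end

/-! ### Derivatives of power series -/

/-- The monomials with coefficients `a i` and total degrees `w i` form an absolutely convergent series
on every polydisc of radius less than `R`. -/
def SummableBelow {ι : Type*} (R : ℝ) (a : ι → ℂ) (w : ι → ℕ) : Prop :=
  ∀ ρ : ℝ, 0 < ρ → ρ < R → Summable fun i => ‖a i‖ * ρ ^ w i

lemma exists_radius_between {R : ℝ} {z : ℂ} (hz : z ∈ Metric.ball 0 R) :
    ∃ ρ, 0 < ρ ∧ ‖z‖ < ρ ∧ ρ < R := by
  obtain ⟨ρ, h1, h2⟩ := exists_between (mem_ball_zero_iff.1 hz)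
  exact ⟨ρ, (norm_nonneg _).trans_lt h1, h1, h2⟩

lemma norm_monomialJet_le {z : ℂ} {ρ : ℝ} (hz : ‖z‖ < ρ) (q k : ℕ) :
    ‖monomialJet q k z‖ ≤ ((ρ - ‖z‖) ^ q)⁻¹ * ρ ^ k := by
  have h := choose_mul_pow_mul_pow_le (norm_nonneg z) (sub_pos.2 hz).le q k
  rw [add_sub_cancel] at h
  have h0 : 0 < (ρ - ‖z‖) ^ q := pow_pos (sub_pos.2 hz) q
  rw [inv_mul_eq_div, le_div_iff₀ h0, monomialJet, norm_mul, norm_pow, Complex.norm_natCast]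
  exact h

lemma hasDerivAt_monomialJet (q k : ℕ) (z : ℂ) :
    HasDerivAt (monomialJet q k) ((q + 1 : ℕ) * monomialJet (q + 1) k z) z := by
  have h := (hasDerivAt_pow (k - q) z).const_mul (k.choose q : ℂ)
  convert! h using 1
  have h1 : ((k.choose (q + 1) * (q + 1) : ℕ) : ℂ) = (k.choose q * (k - q) : ℕ) := by
    rw [Nat.choose_succ_right_eq]
  rw [Nat.cast_mul, Nat.cast_mul] at h1
  rw [monomialJet, ← mul_assoc, mul_comm ((q + 1 : ℕ) : ℂ), h1, Nat.sub_sub, mul_assoc]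

namespace SummableBelow

variable {ι : Type*} {R : ℝ} {a : ι → ℂ} {k w : ι → ℕ}

lemma mul_monomialJet (h : SummableBelow R a fun i => k i + w i) {z : ℂ}
    (hz : z ∈ Metric.ball 0 R) (q : ℕ) (C : ℂ) :
    SummableBelow R (fun i => a i * (C * monomialJet q (k i) z)) w := by
  intro ρ hρ hρR
  obtain ⟨r, hr, hzr, hrR⟩ := exists_radius_between hz
  have hs := h (max ρ r) (lt_max_of_lt_left hρ) (max_lt hρR hrR)
  have hzm : ‖z‖ < max ρ r := lt_max_of_lt_right hzr
  have hm : 0 < max ρ r := lt_max_of_lt_left hρ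
  refine .of_nonneg_of_le (fun i => by positivity) (fun i => ?_)
    (hs.mul_left (‖C‖ * ((max ρ r - ‖z‖) ^ q)⁻¹))
  have h1 := norm_monomialJet_le hzm q (k i)
  have h2 : ρ ^ w i ≤ max ρ r ^ w i := pow_le_pow_left₀ hρ.le (le_max_left _ _) _
  calc ‖a i * (C * monomialJet q (k i) z)‖ * ρ ^ w i
      = ‖a i‖ * (‖C‖ * ‖monomialJet q (k i) z‖) * ρ ^ w i := by rw [norm_mul, norm_mul]
    _ ≤ ‖a i‖ * (‖C‖ * (((max ρ r - ‖z‖) ^ q)⁻¹ * max ρ r ^ k i)) * max ρ r ^ w i := by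
      gcongr
    _ = _ := by rw [pow_add]; ring

lemma mul_pow (h : SummableBelow R a fun i => k i + w i) {z : ℂ} (hz : z ∈ Metric.ball 0 R) :
    SummableBelow R (fun i => a i * z ^ k i) w := by
  simpa [monomialJet] using h.mul_monomialJet hz 0 1

lemma summable_mul_pow (h : SummableBelow R a k) {z : ℂ} (hz : z ∈ Metric.ball 0 R) :
    Summable fun i => a i * z ^ k i := by
  obtain ⟨ρ, hρ, hzρ, hρR⟩ := exists_radius_between hz
  refine .of_norm_bounded (h ρ hρ hρR) fun i => ?_
  rw [norm_mul, norm_pow]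
  gcongr

/-- An absolutely convergent power series may be differentiated term by term any number of times. -/
lemma hasSum_iteratedDeriv (h : SummableBelow R a k) {g : ℂ → ℂ}
    (hg : ∀ z ∈ Metric.ball 0 R, HasSum (fun i => a i * z ^ k i) (g z)) (q : ℕ) :
    ∀ z ∈ Metric.ball 0 R,
      HasSum (fun i => a i * (q.factorial * monomialJet q (k i) z)) (iteratedDeriv q g z) := by
  induction q with
  | zero => simpa [monomialJet] using hg
  | succ q ih =>
    intro z hz
    obtain ⟨ρ, hρ, hzρ, hρR⟩ := exists_radius_between hz
    obtain ⟨r, hρr, hrR⟩ := exists_between hρR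
    have hr : 0 < r := hρ.trans hρr
    have hfac : ((q + 1).factorial : ℂ) = q.factorial * (q + 1 : ℕ) := by
      rw [Nat.factorial_succ, Nat.cast_mul, mul_comm]
    have hbound : ∀ i, ∀ y ∈ Metric.ball (0 : ℂ) ρ,
        ‖a i * ((q + 1).factorial * monomialJet (q + 1) (k i) y)‖ ≤
          ((q + 1).factorial * ((r - ρ) ^ (q + 1))⁻¹) * (‖a i‖ * r ^ k i) := fun i y hy => by
      have hy' : ‖y‖ < ρ := mem_ball_zero_iff.1 hy
      have hrρ : 0 < r - ρ := sub_pos.2 hρr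
      calc _ = ‖a i‖ * ((q + 1).factorial * ‖monomialJet (q + 1) (k i) y‖) := by
            rw [norm_mul, norm_mul, Complex.norm_natCast]
        _ ≤ ‖a i‖ * ((q + 1).factorial * (((r - ‖y‖) ^ (q + 1))⁻¹ * r ^ k i)) := by
            gcongr
            exact norm_monomialJet_le (hy'.trans hρr) _ _
        _ ≤ ‖a i‖ * ((q + 1).factorial * (((r - ρ) ^ (q + 1))⁻¹ * r ^ k i)) := by
            gcongr
        _ = _ := by ring
    have hsum : Summable fun i =>
        ((q + 1).factorial * ((r - ρ) ^ (q + 1))⁻¹) * (‖a i‖ * r ^ k i) := (h r hr hrR).mul_left _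
    have hzb : z ∈ Metric.ball (0 : ℂ) ρ := mem_ball_zero_iff.2 hzρ
    have hd := hasDerivAt_tsum_of_isPreconnected (y₀ := z) hsum Metric.isOpen_ball
      (convex_ball (0 : ℂ) ρ).isPreconnected
      (g := fun i y => a i * (q.factorial * monomialJet q (k i) y))
      (g' := fun i y => a i * ((q + 1).factorial * monomialJet (q + 1) (k i) y))
      (fun i y _ => by
        rw [hfac, mul_assoc (q.factorial : ℂ)]
        exact ((hasDerivAt_monomialJet q (k i) y).const_mul _).const_mul _)
      hbound hzb (ih z hz).summable hzb
    have heq : iteratedDeriv q g =ᶠ[𝓝 z]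
        fun y => ∑' i, a i * (q.factorial * monomialJet q (k i) y) := by
      filter_upwards [Metric.isOpen_ball.mem_nhds hz] with y hy
      exact (ih y hy).tsum_eq.symm
    rw [iteratedDeriv_succ, (hd.congr_of_eventuallyEq heq).deriv]
    exact (Summable.of_norm_bounded hsum fun i => hbound i z hzb).hasSum

end SummableBelow

lemma hasSum_taylorCoeff₂ {R : ℝ} {β : ℂ → ℂ → ℂ} {c : ℕ × ℕ → ℂ}
    (hc : SummableBelow R c fun p => p.1 + p.2)
    (hβ : ∀ x ∈ Metric.ball (0 : ℂ) R, ∀ y ∈ Metric.ball (0 : ℂ) R,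
      HasSum (fun p => c p * (x ^ p.1 * y ^ p.2)) (β x y))
    (q₁ q₂ : ℕ) {x y : ℂ} (hx : x ∈ Metric.ball 0 R) (hy : y ∈ Metric.ball 0 R) :
    HasSum (fun p => c p * (monomialJet q₁ p.1 x * monomialJet q₂ p.2 y))
      (taylorCoeff₂ β q₁ q₂ x y) := by
  have h2 : ∀ x' ∈ Metric.ball (0 : ℂ) R, HasSum
      (fun p => c p * (q₂.factorial * monomialJet q₂ p.2 y) * x' ^ p.1)
      (iteratedDeriv q₂ (fun y' => β x' y') y) := fun x' hx' => by
    have h := (hc.mul_pow hx').hasSum_iteratedDeriv (g := fun y' => β x' y')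
      (fun y' hy' => by simpa only [mul_assoc] using hβ x' hx' y' hy') q₂ y hy
    refine h.congr_fun fun p => ?_
    ring
  have hc' : SummableBelow R c fun p => p.2 + p.1 := by simpa only [add_comm] using hc
  have h1 := ((hc'.mul_monomialJet hy q₂ q₂.factorial).hasSum_iteratedDeriv h2 q₁ x hx).div_const
    ((q₁.factorial : ℂ) * q₂.factorial)
  refine h1.congr_fun fun p => ?_
  have e1 : (q₁.factorial : ℂ) ≠ 0 := Nat.cast_ne_zero.2 (Nat.factorial_ne_zero _)
  have e2 : (q₂.factorial : ℂ) ≠ 0 := Nat.cast_ne_zero.2 (Nat.factorial_ne_zero _)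
  field_simp

lemma hasSum_taylorCoeff₃ {R : ℝ} {β : ℂ → ℂ → ℂ → ℂ} {c : ℕ × ℕ × ℕ → ℂ}
    (hc : SummableBelow R c fun p => p.1 + (p.2.1 + p.2.2))
    (hβ : ∀ x ∈ Metric.ball (0 : ℂ) R, ∀ y ∈ Metric.ball (0 : ℂ) R, ∀ z ∈ Metric.ball (0 : ℂ) R,
      HasSum (fun p => c p * (x ^ p.1 * (y ^ p.2.1 * z ^ p.2.2))) (β x y z))
    (q₁ q₂ q₃ : ℕ) {x y z : ℂ} (hx : x ∈ Metric.ball 0 R) (hy : y ∈ Metric.ball 0 R)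
    (hz : z ∈ Metric.ball 0 R) :
    HasSum (fun p => c p * (monomialJet q₁ p.1 x *
      (monomialJet q₂ p.2.1 y * monomialJet q₃ p.2.2 z))) (taylorCoeff₃ β q₁ q₂ q₃ x y z) := by
  have hc' : SummableBelow R c fun p => p.2.2 + (p.2.1 + p.1) := by
    convert hc using 2
    ring
  have hc'' : SummableBelow R c fun p => p.2.2 + (p.1 + p.2.1) := by
    convert hc using 2
    ring
  have h3 : ∀ x' ∈ Metric.ball (0 : ℂ) R, ∀ y' ∈ Metric.ball (0 : ℂ) R, HasSum
      (fun p => c p * (q₃.factorial * monomialJet q₃ p.2.2 z) * x' ^ p.1 * y' ^ p.2.1)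
      (iteratedDeriv q₃ (fun z' => β x' y' z') z) := fun x' hx' y' hy' => by
    have h := ((hc.mul_pow hx').mul_pow hy').hasSum_iteratedDeriv (g := fun z' => β x' y' z')
      (fun z' hz' => by simpa only [mul_assoc] using hβ x' hx' y' hy' z' hz') q₃ z hz
    refine h.congr_fun fun p => ?_
    ring
  have h2 : ∀ x' ∈ Metric.ball (0 : ℂ) R, HasSum
      (fun p => c p * (q₃.factorial * monomialJet q₃ p.2.2 z) *
        (q₂.factorial * monomialJet q₂ p.2.1 y) * x' ^ p.1)
      (iteratedDeriv q₂ (fun y' => iteratedDeriv q₃ (fun z' => β x' y' z') z) y) := fun x' hx' => by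
    have h := ((hc''.mul_monomialJet hz q₃ q₃.factorial).mul_pow hx').hasSum_iteratedDeriv
      (h3 x' hx') q₂ y hy
    refine h.congr_fun fun p => ?_
    ring
  have h1 := (((hc'.mul_monomialJet hz q₃ q₃.factorial).mul_monomialJet hy q₂
    q₂.factorial).hasSum_iteratedDeriv h2 q₁ x hx).div_const
    ((q₁.factorial : ℂ) * q₂.factorial * q₃.factorial)
  refine h1.congr_fun fun p => ?_
  have e1 : (q₁.factorial : ℂ) ≠ 0 := Nat.cast_ne_zero.2 (Nat.factorial_ne_zero _)
  have e2 : (q₂.factorial : ℂ) ≠ 0 := Nat.cast_ne_zero.2 (Nat.factorial_ne_zero _)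
  have e3 : (q₃.factorial : ℂ) ≠ 0 := Nat.cast_ne_zero.2 (Nat.factorial_ne_zero _)
  field_simp

/-! ### Divided differences of power series -/

lemma pow_succ_sub_pow_succ_eq_sum {A : Type*} [Ring A] (a b : A) (n : ℕ) :
    a ^ (n + 1) - b ^ (n + 1) =
      ∑ p ∈ Finset.HasAntidiagonal.antidiagonal n, a ^ p.1 * ((a - b) * b ^ p.2) := by
  induction n with
  | zero => simp
  | succ n ih =>
    rw [Finset.Nat.sum_antidiagonal_succ']
    have h : ∑ p ∈ Finset.HasAntidiagonal.antidiagonal n, a ^ p.1 * ((a - b) * b ^ (p.2 + 1)) =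
        (a ^ (n + 1) - b ^ (n + 1)) * b := by
      rw [ih, Finset.sum_mul]
      simp only [pow_succ, mul_assoc]
    rw [h, pow_succ a (n + 1), pow_succ b (n + 1)]
    noncomm_ring

lemma HasSum.sum_antidiagonal {V : Type*} [AddCommMonoid V] [TopologicalSpace V] [ContinuousAdd V]
    [RegularSpace V] {f : ℕ × ℕ → V} {s : V} (h : HasSum f s) :
    HasSum (fun n => ∑ p ∈ Finset.HasAntidiagonal.antidiagonal n, f p) s := by
  have h1 := (Finset.HasAntidiagonal.sigmaAntidiagonalEquivProd (A := ℕ)).hasSum_iff.2 h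
  refine h1.sigma fun n => ?_
  have h2 := hasSum_fintype fun p : Finset.HasAntidiagonal.antidiagonal n => f p
  rwa [Finset.sum_coe_sort (Finset.HasAntidiagonal.antidiagonal n) f] at h2

namespace SummableBelow

variable {R : ℝ} {a : ℕ → ℂ}

/-- Cauchy's estimate for the coefficients, in the form of a geometric majorant. -/
lemma exists_norm_mul_pow_le (h : SummableBelow R a id) {ρ : ℝ} (hρ : 0 < ρ) (hρR : ρ < R) (s : ℕ) :
    ∃ C θ : ℝ, 0 < θ ∧ θ < 1 ∧ ∀ n, ‖a (n + s)‖ * ρ ^ n ≤ C * θ ^ n := by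
  obtain ⟨r, hρr, hrR⟩ := exists_between hρR
  have hr : 0 < r := hρ.trans hρr
  have hs := h r hr hrR
  obtain ⟨C, hC⟩ := hs.tendsto_atTop_zero.bddAbove_range
  refine ⟨C / r ^ s, ρ / r, by positivity, (div_lt_one hr).2 hρr, fun n => ?_⟩
  have h1 : ‖a (n + s)‖ * r ^ (n + s) ≤ C := hC ⟨n + s, rfl⟩
  calc ‖a (n + s)‖ * ρ ^ n = ‖a (n + s)‖ * r ^ (n + s) / r ^ s * (ρ / r) ^ n := by
        rw [div_pow, pow_add]; field_simp
    _ ≤ C / r ^ s * (ρ / r) ^ n := by gcongr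

lemma prod₂ (h : SummableBelow R a id) :
    SummableBelow R (fun p : ℕ × ℕ => a (p.1 + p.2 + 1)) fun p => p.1 + p.2 := by
  intro ρ hρ hρR
  obtain ⟨C, θ, hθ, hθ1, hC⟩ := h.exists_norm_mul_pow_le hρ hρR 1
  have hg := summable_geometric_of_lt_one hθ.le hθ1
  refine .of_nonneg_of_le (fun _ => by positivity) (fun p => ?_)
    ((hg.mul_of_nonneg hg (fun _ => by positivity) fun _ => by positivity).mul_left C)
  rw [← pow_add]
  exact hC _

lemma prod₃ (h : SummableBelow R a id) :
    SummableBelow R (fun p : ℕ × ℕ × ℕ => a (p.1 + (p.2.1 + p.2.2) + 2))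
      fun p => p.1 + (p.2.1 + p.2.2) := by
  intro ρ hρ hρR
  obtain ⟨C, θ, hθ, hθ1, hC⟩ := h.exists_norm_mul_pow_le hρ hρR 2
  have hg := summable_geometric_of_lt_one hθ.le hθ1
  have hgg := hg.mul_of_nonneg hg (fun _ => by positivity) fun _ => by positivity
  refine .of_nonneg_of_le (fun _ => by positivity) (fun p => ?_)
    ((hg.mul_of_nonneg hgg (fun _ => by positivity) fun _ => by positivity).mul_left C)
  rw [← pow_add, ← pow_add]
  exact hC _

/-- The divided difference of a power series: `(y ^ (n + 1) - x ^ (n + 1)) / (y - x)` is the sum of the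
monomials of degree `n` in `x` and `y`. -/
lemma hasSum_dslope (h : SummableBelow R a id) {g : ℂ → ℂ}
    (hg : ∀ z ∈ Metric.ball 0 R, HasSum (fun n => a n * z ^ n) (g z)) {x y : ℂ}
    (hx : x ∈ Metric.ball 0 R) (hy : y ∈ Metric.ball 0 R) :
    HasSum (fun p : ℕ × ℕ => a (p.1 + p.2 + 1) * (x ^ p.1 * y ^ p.2)) (dslope g x y) := by
  have hs : Summable fun p : ℕ × ℕ => a (p.1 + p.2 + 1) * (x ^ p.1 * y ^ p.2) := by
    simpa only [mul_assoc] using (h.prod₂.mul_pow hx).summable_mul_pow hy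
  have h1 := hs.hasSum.sum_antidiagonal
  have h2 : ∀ n, ∑ p ∈ Finset.HasAntidiagonal.antidiagonal n,
      a (p.1 + p.2 + 1) * (x ^ p.1 * y ^ p.2) =
      a (n + 1) * ∑ p ∈ Finset.HasAntidiagonal.antidiagonal n, x ^ p.1 * y ^ p.2 := fun n => by
    rw [Finset.mul_sum]
    refine Finset.sum_congr rfl fun p hp => ?_
    rw [Finset.HasAntidiagonal.mem_antidiagonal.1 hp]
  simp only [h2] at h1
  suffices hlim : HasSum
      (fun n => a (n + 1) * ∑ p ∈ Finset.HasAntidiagonal.antidiagonal n, x ^ p.1 * y ^ p.2)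
      (dslope g x y) by
    rw [← h1.unique hlim]
    exact hs.hasSum
  rcases eq_or_ne y x with rfl | hxy
  · rw [dslope_same, ← iteratedDeriv_one]
    have h3 := h.hasSum_iteratedDeriv hg 1 y hy
    rw [← hasSum_nat_add_iff' 1] at h3
    simp only [Finset.range_one, Finset.sum_singleton] at h3
    have h4 : monomialJet 1 (id 0) y = 0 := by simp [monomialJet]
    rw [h4, mul_zero, mul_zero, sub_zero] at h3
    refine h3.congr_fun fun n => ?_
    congr 1
    simp only [← pow_add]
    rw [Finset.sum_congr rfl fun p hp => by rw [Finset.HasAntidiagonal.mem_antidiagonal.1 hp]]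
    simp [monomialJet]
  · rw [dslope_of_ne _ hxy, slope_def_field]
    have h3 := (hg y hy).sub (hg x hx)
    rw [← hasSum_nat_add_iff' 1] at h3
    simp only [Finset.range_one, Finset.sum_singleton, pow_zero, sub_self, sub_zero] at h3
    refine (h3.div_const (y - x)).congr_fun fun n => ?_
    have hyx : y - x ≠ 0 := sub_ne_zero.2 hxy
    rw [eq_div_iff hyx, ← mul_sub, mul_assoc]
    congr 1
    rw [← neg_sub (x ^ (n + 1)), pow_succ_sub_pow_succ_eq_sum, Finset.sum_mul,
      ← Finset.sum_neg_distrib]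
    refine Finset.sum_congr rfl fun p _ => ?_
    ring

lemma hasSum_divDiff₂ (h : SummableBelow R a id) {f : ℂ → ℂ}
    (hf : ∀ z ∈ Metric.ball 0 R, HasSum (fun n => a n * z ^ n) (f z)) {x y z : ℂ}
    (hx : x ∈ Metric.ball 0 R) (hy : y ∈ Metric.ball 0 R) (hz : z ∈ Metric.ball 0 R) :
    HasSum (fun p : ℕ × ℕ × ℕ => a (p.1 + (p.2.1 + p.2.2) + 2) *
      (x ^ p.1 * (y ^ p.2.1 * z ^ p.2.2))) (divDiff₂ f x y z) := by
  -- expand `f^{[1]}(x, ·)` in powers of its second argument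
  have hsx' : ∀ ρ, 0 < ρ → ρ < R →
      Summable fun p : ℕ × ℕ => ‖a (p.2 + p.1 + 1) * x ^ p.2‖ * ρ ^ p.1 := fun ρ hρ hρR =>
    (h.prod₂.mul_pow hx ρ hρ hρR).prod_symm
  have hsx : ∀ l, Summable fun k => a (k + l + 1) * x ^ k := fun l => by
    obtain ⟨ρ, hρ, -, hρR⟩ := exists_radius_between hx
    exact ((summable_mul_right_iff (pow_ne_zero l hρ.ne')).1
      ((hsx' ρ hρ hρR).prod_factor l)).of_norm
  have hb : SummableBelow R (fun l => ∑' k, a (k + l + 1) * x ^ k) id := by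
    intro ρ hρ hρR
    refine .of_nonneg_of_le (fun _ => by positivity) (fun l => ?_) (hsx' ρ hρ hρR).prod
    simp only [id, tsum_mul_right]
    exact mul_le_mul_of_nonneg_right (norm_tsum_le_tsum_norm (hsx l).norm) (by positivity)
  have hg : ∀ t ∈ Metric.ball (0 : ℂ) R,
      HasSum (fun l => (∑' k, a (k + l + 1) * x ^ k) * t ^ l) (divDiff₁ f x t) := fun t ht => by
    have h1 := (Equiv.prodComm ℕ ℕ).hasSum_iff.2 (h.hasSum_dslope hf hx ht)
    refine h1.prod_fiberwise fun l => ?_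
    refine ((hsx l).hasSum.mul_right (t ^ l)).congr_fun fun k => ?_
    simp [mul_assoc]
  have h2 := hb.hasSum_dslope hg hy hz
  have hs : Summable fun p : ℕ × ℕ × ℕ => a (p.1 + (p.2.1 + p.2.2) + 2) *
      (x ^ p.1 * (y ^ p.2.1 * z ^ p.2.2)) := by
    simpa only [mul_assoc] using ((h.prod₃.mul_pow hx).mul_pow hy).summable_mul_pow hz
  have h3 := (Equiv.prodComm (ℕ × ℕ) ℕ).hasSum_iff.2 hs.hasSum
  have h4 := h3.prod_fiberwise fun p => ((hsx (p.1 + p.2 + 1)).hasSum.mul_right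
    (y ^ p.1 * z ^ p.2)).congr_fun fun k => by
      simp [mul_assoc, add_assoc]
  rw [divDiff₂, ← h4.unique h2]
  exact hs.hasSum

end SummableBelow

lemma exists_powerSeries {f : ℂ → ℂ} {R : ℝ} (hf : AnalyticOnNhd ℂ f (Metric.ball 0 R)) :
    ∃ a : ℕ → ℂ, SummableBelow R a id ∧
      ∀ z ∈ Metric.ball 0 R, HasSum (fun n => a n * z ^ n) (f z) := by
  have h : ∀ z ∈ Metric.ball 0 R,
      HasSum (fun n => (n.factorial : ℂ)⁻¹ * iteratedDeriv n f 0 * z ^ n) (f z) := fun z hz => by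
    refine (Complex.hasSum_taylorSeries_on_ball hf.differentiableOn hz).congr_fun fun n => ?_
    simp only [sub_zero, smul_eq_mul]
    ring
  refine ⟨_, fun ρ hρ hρR => ?_, h⟩
  have h1 := (h (ρ : ℂ) (by simpa [abs_of_pos hρ] using hρR)).summable.norm
  refine h1.congr fun n => ?_
  rw [norm_mul, norm_pow, Complex.norm_real, Real.norm_of_nonneg hρ.le, id]

/-! ### The perturbation formula -/

section

variable {V : Type*} [NormedAddCommGroup V] [CompleteSpace V]

lemma Summable.tsum_prod_eq_tsum_snd {G : ℕ × ℕ → V} (h : Summable G) :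
    ∑' p, G p = ∑' l, ∑' k, G (k, l) := by
  rw [← (Equiv.prodComm ℕ ℕ).tsum_eq G]
  exact Summable.tsum_prod h.prod_symm

lemma Summable.tsum_prod_eq_tsum_antidiagonal {F : ℕ × ℕ × ℕ → V} (h : Summable F) :
    ∑' p, F p = ∑' l, ∑' n, ∑ p ∈ Finset.HasAntidiagonal.antidiagonal n, F (p.1, p.2, l) := by
  let e : ℕ × (ℕ × ℕ) ≃ ℕ × ℕ × ℕ := (Equiv.prodComm ℕ (ℕ × ℕ)).trans (Equiv.prodAssoc ℕ ℕ ℕ)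
  have h' : Summable fun p => F (e p) := e.summable_iff.2 h
  rw [← e.tsum_eq F, h'.tsum_prod]
  exact tsum_congr fun l => (h'.prod_factor l).hasSum.sum_antidiagonal.tsum_eq.symm

end

/-- The telescoping identity behind the perturbation formula: monomial by monomial,
`A ^ (n + 1) - B ^ (n + 1)` is the sum of `A ^ i (A - B) B ^ j` over `i + j = n`. -/
lemma tsum_sub_tsum_eq_tsum {𝔸 : Type*} [NormedRing 𝔸] [NormedAlgebra ℂ 𝔸] [CompleteSpace 𝔸]
    (A B X Y : 𝔸) (a : ℕ → ℂ)
    (hA : Summable fun p : ℕ × ℕ => a (p.1 + p.2 + 1) • (A ^ p.1 * (Y * X ^ p.2)))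
    (hB : Summable fun p : ℕ × ℕ => a (p.1 + p.2 + 1) • (B ^ p.1 * (Y * X ^ p.2)))
    (hAB : Summable fun p : ℕ × ℕ × ℕ => a (p.1 + (p.2.1 + p.2.2) + 2) •
      (A ^ p.1 * ((A - B) * (B ^ p.2.1 * (Y * X ^ p.2.2))))) :
    ∑' p : ℕ × ℕ, a (p.1 + p.2 + 1) • (A ^ p.1 * (Y * X ^ p.2)) -
        ∑' p : ℕ × ℕ, a (p.1 + p.2 + 1) • (B ^ p.1 * (Y * X ^ p.2)) =
      ∑' p : ℕ × ℕ × ℕ, a (p.1 + (p.2.1 + p.2.2) + 2) •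
        (A ^ p.1 * ((A - B) * (B ^ p.2.1 * (Y * X ^ p.2.2)))) := by
  have hs := hA.sub hB
  rw [← hA.tsum_sub hB, hs.tsum_prod_eq_tsum_snd, hAB.tsum_prod_eq_tsum_antidiagonal]
  refine tsum_congr fun l => ?_
  -- the term with exponent `0` vanishes, and the others telescope
  refine (hs.prod_symm.prod_factor l).tsum_eq_zero_add.trans ?_
  simp only [Prod.swap_prod_mk, pow_zero, sub_self, zero_add]
  refine tsum_congr fun n => ?_
  rw [← smul_sub, ← sub_mul, pow_succ_sub_pow_succ_eq_sum, Finset.sum_mul, Finset.smul_sum]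
  refine Finset.sum_congr rfl fun p hp => ?_
  have hn : p.1 + (p.2 + l) + 2 = n + 1 + l + 1 := by
    rw [← Finset.HasAntidiagonal.mem_antidiagonal.1 hp]
    ring
  simp only [hn, mul_assoc]

section

variable {H : Type*} [NormedAddCommGroup H] [InnerProductSpace ℂ H]

lemma JetExpansion.norm_pow_le {X : SpectralOperator H} {ρ : ℝ} (J : JetExpansion X ρ) (k : ℕ) :
    ‖X.op ^ k‖ ≤ J.const * ρ ^ k :=
  (J.hasSum_jet k).norm_le_of_bounded (J.hasSum_bound k) fun q => J.norm_jet_le q k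

lemma summable_smul_pow_mul_pow [CompleteSpace H] {X₁ X₂ : SpectralOperator H} {ρ : ℝ}
    (J₁ : JetExpansion X₁ ρ) (J₂ : JetExpansion X₂ ρ) (Y : H →L[ℂ] H) {c : ℕ × ℕ → ℂ}
    (hc : Summable fun p => ‖c p‖ * (ρ ^ p.1 * ρ ^ p.2)) :
    Summable fun p => c p • (X₁.op ^ p.1 * (Y * X₂.op ^ p.2)) := by
  refine .of_norm_bounded (hc.mul_right (J₁.const * ‖Y‖ * J₂.const)) fun p => ?_
  rw [norm_smul]
  calc _ ≤ ‖c p‖ * ((J₁.const * ρ ^ p.1) * (‖Y‖ * (J₂.const * ρ ^ p.2))) := by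
        gcongr
        exact norm_mul_le_of_le (J₁.norm_pow_le _) (norm_mul_le_of_le le_rfl (J₂.norm_pow_le _))
    _ = _ := by ring

lemma summable_smul_pow_mul_pow_mul_pow [CompleteSpace H] {X₁ X₂ X₃ : SpectralOperator H} {ρ : ℝ}
    (J₁ : JetExpansion X₁ ρ) (J₂ : JetExpansion X₂ ρ) (J₃ : JetExpansion X₃ ρ)
    (Y₁ Y₂ : H →L[ℂ] H) {c : ℕ × ℕ × ℕ → ℂ}
    (hc : Summable fun p => ‖c p‖ * (ρ ^ p.1 * (ρ ^ p.2.1 * ρ ^ p.2.2))) :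
    Summable fun p => c p • (X₁.op ^ p.1 * (Y₁ * (X₂.op ^ p.2.1 * (Y₂ * X₃.op ^ p.2.2)))) := by
  refine .of_norm_bounded (hc.mul_right (J₁.const * ‖Y₁‖ * J₂.const * ‖Y₂‖ * J₃.const)) fun p => ?_
  rw [norm_smul]
  calc _ ≤ ‖c p‖ * ((J₁.const * ρ ^ p.1) * (‖Y₁‖ * ((J₂.const * ρ ^ p.2.1) *
          (‖Y₂‖ * (J₃.const * ρ ^ p.2.2))))) := by
        gcongr
        exact norm_mul_le_of_le (J₁.norm_pow_le _) (norm_mul_le_of_le le_rfl (norm_mul_le_of_le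
          (J₂.norm_pow_le _) (norm_mul_le_of_le le_rfl (J₃.norm_pow_le _))))
    _ = _ := by ring

lemma isGDOI_of_subsingleton [Subsingleton H] (β : ℂ → ℂ → ℂ) (X₁ X₂ : SpectralOperator H)
    (Y T : H →L[ℂ] H) : IsGDOI β X₁ X₂ Y T :=
  ⟨fun _ => 0, fun _ _ ε hε => ⟨1, one_pos, fun _ _ _ _ => by
    exact (norm_of_subsingleton _).trans_le hε.le⟩, by
    rw [Subsingleton.elim T 0]; exact hasSum_zero⟩

lemma isGTOI_of_subsingleton [Subsingleton H] (β : ℂ → ℂ → ℂ → ℂ) (X₁ X₂ X₃ : SpectralOperator H)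
    (Y₁ Y₂ T : H →L[ℂ] H) : IsGTOI β X₁ X₂ X₃ Y₁ Y₂ T :=
  ⟨fun _ => 0, fun _ _ _ ε hε => ⟨1, one_pos, fun _ _ _ _ _ _ => by
    exact (norm_of_subsingleton _).trans_le hε.le⟩, by
    rw [Subsingleton.elim T 0]; exact hasSum_zero⟩

lemma spectralRadius_lt_of_spectrum_subset_ball {𝔸 : Type*} [NormedRing 𝔸] [NormedAlgebra ℂ 𝔸]
    [CompleteSpace 𝔸] [Nontrivial 𝔸] {a : 𝔸} {R : ℝ} (h : spectrum ℂ a ⊆ Metric.ball 0 R) :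
    spectralRadius ℂ a < ENNReal.ofReal R := by
  refine spectrum.spectralRadius_lt_of_forall_lt a fun z hz => ?_
  have hzR := mem_ball_zero_iff.1 (h hz)
  rw [← NNReal.coe_lt_coe, coe_nnnorm, Real.coe_toNNReal _ ((norm_nonneg z).trans hzR.le)]
  exact hzR

end

theorem mainTheorem11 {H : Type*} [NormedAddCommGroup H] [InnerProductSpace ℂ H] [CompleteSpace H]
    (A B X : SpectralOperator H) (Y : H →L[ℂ] H) (f : ℂ → ℂ) (R : ℝ)
    (hf : AnalyticOnNhd ℂ f (Metric.ball 0 R))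
    (hA : spectrum ℂ A.op ⊆ Metric.ball 0 R)
    (hB : spectrum ℂ B.op ⊆ Metric.ball 0 R)
    (hX : spectrum ℂ X.op ⊆ Metric.ball 0 R) :
    (∃! T, IsGDOI (divDiff₁ f) A X Y T) ∧
    (∃! T, IsGDOI (divDiff₁ f) B X Y T) ∧
    (∃! T, IsGTOI (divDiff₂ f) A B X (A.op - B.op) Y T) ∧
    gdoi (divDiff₁ f) A X Y - gdoi (divDiff₁ f) B X Y =
      gtoi (divDiff₂ f) A B X (A.op - B.op) Y := by
  suffices h : ∃ T₁ T₂ T₃, IsGDOI (divDiff₁ f) A X Y T₁ ∧ IsGDOI (divDiff₁ f) B X Y T₂ ∧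
      IsGTOI (divDiff₂ f) A B X (A.op - B.op) Y T₃ ∧ T₁ - T₂ = T₃ by
    obtain ⟨T₁, T₂, T₃, h₁, h₂, h₃, h⟩ := h
    refine ⟨⟨T₁, h₁, fun T hT => hT.unique h₁⟩, ⟨T₂, h₂, fun T hT => hT.unique h₂⟩,
      ⟨T₃, h₃, fun T hT => hT.unique h₃⟩, ?_⟩
    rw [h₁.gdoi_eq, h₂.gdoi_eq, h₃.gtoi_eq, h]
  -- spectra are nonempty, hence `0 < R`, only when `H` is nontrivial
  rcases subsingleton_or_nontrivial H with hH | hH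
  · exact ⟨0, 0, 0, isGDOI_of_subsingleton _ _ _ _ _, isGDOI_of_subsingleton _ _ _ _ _,
      isGTOI_of_subsingleton _ _ _ _ _ _ _, sub_self 0⟩
  obtain ⟨a, ha, hfa⟩ := exists_powerSeries hf
  -- one radius `ρ < R` above the spectral radii of the three operators
  obtain ⟨ρ', hρ', hρR'⟩ := exists_between (max_lt (spectralRadius_lt_of_spectrum_subset_ball hA)
    (max_lt (spectralRadius_lt_of_spectrum_subset_ball hB)
      (spectralRadius_lt_of_spectrum_subset_ball hX)))
  obtain ⟨ρ, rfl⟩ : ∃ ρ : ℝ, ρ' = ENNReal.ofReal ρ :=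
    ⟨ρ'.toReal, (ENNReal.ofReal_toReal hρR'.ne_top).symm⟩
  have hρ : 0 < ρ := ENNReal.ofReal_pos.1 (bot_le.trans_lt hρ')
  have hρR : ρ < R := (ENNReal.ofReal_lt_ofReal_iff_of_nonneg hρ.le).1 hρR'
  obtain ⟨JA⟩ := A.nonempty_jetExpansion ((le_max_left _ _).trans_lt hρ')
  obtain ⟨JB⟩ := B.nonempty_jetExpansion
    (((le_max_left _ _).trans (le_max_right _ _)).trans_lt hρ')
  obtain ⟨JX⟩ := X.nonempty_jetExpansion
    (((le_max_right _ _).trans (le_max_right _ _)).trans_lt hρ')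
  have hc₂ := ha.prod₂ ρ hρ hρR
  have hc₃ := ha.prod₃ ρ hρ hρR
  simp only [pow_add] at hc₂ hc₃
  have hT₂ : ∀ q₁ q₂, ∀ x ∈ Metric.ball (0 : ℂ) R, ∀ y ∈ Metric.ball (0 : ℂ) R, HasSum
      (fun p : ℕ × ℕ => a (p.1 + p.2 + 1) * (monomialJet q₁ p.1 x * monomialJet q₂ p.2 y))
      (taylorCoeff₂ (divDiff₁ f) q₁ q₂ x y) := fun q₁ q₂ x hx y hy =>
    hasSum_taylorCoeff₂ ha.prod₂ (fun x hx y hy => ha.hasSum_dslope hfa hx hy) q₁ q₂ hx hy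
  refine ⟨_, _, _, isGDOI_tsum JA JX Y hc₂ fun q₁ q₂ x hx y hy => hT₂ q₁ q₂ x (hA hx) y (hX hy),
    isGDOI_tsum JB JX Y hc₂ fun q₁ q₂ x hx y hy => hT₂ q₁ q₂ x (hB hx) y (hX hy),
    isGTOI_tsum JA JB JX (A.op - B.op) Y hc₃ fun q₁ q₂ q₃ x hx y hy z hz =>
      hasSum_taylorCoeff₃ ha.prod₃ (fun x hx y hy z hz => ha.hasSum_divDiff₂ hfa hx hy hz)
        q₁ q₂ q₃ (hA hx) (hB hy) (hX hz), ?_⟩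
  exact tsum_sub_tsum_eq_tsum A.op B.op X.op Y a (summable_smul_pow_mul_pow JA JX Y hc₂)
    (summable_smul_pow_mul_pow JB JX Y hc₂)
    (summable_smul_pow_mul_pow_mul_pow JA JB JX (A.op - B.op) Y hc₃)
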